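/- **Setting.** An algorithm $\mathcal A$ is given by integers $k\le n$, a unitary operator on $n$ qubits (also written $\mathcal A$), a choice of $k$ of the $n$ qubits and a function $\phi:\{0,1\}^k\to\mathbb R$. It applies the unitary to $|0^n\rangle$, measures the chosen qubits in the computational basis, and on outcome $x$ outputs $v(\mathcal A)=\phi(x)$. Let $|\psi\rangle=\mathcal A|0^n\rangle$ and $U=2|\psi\rangle\langle\psi|-I$. The procedures below know $n$, the chosen qubits and $\phi$, but access the unitary only through copies of $|\psi\rangle$ and (possibly controlled) uses of $U$. Changing $\phi$ to $g\circ\phi$ gives the algorithm that outputs $g(v(\mathcal A))$. Below, $D,c>0$ are constants; "powering with parameter $\delta$" means to run a procedure $\lceil c\ln(1/\delta)\rceil$ times independently and to take the median. *Algorithm 1* (outputs in $[0,1]$; integer $t\ge1$, $\delta>0$). Powering with parameter $\delta$ of $t$-step amplitude estimation for the state $|\psi'\rangle=\sum_{z\in\{0,1\}^n}\langle z|\psi\rangle\,|z\rangle(\sqrt{1-\phi(z_S)}\,|0\rangle+\sqrt{\phi(z_S)}\,|1\rangle)$ (where $z_S\in\{0,1\}^k$ is the part of $z$ on the measured qubits)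 and the projector $P=I\otimes|1\rangle\langle1|$. That is: with $Q=(2|\psi'\rangle\langle\psi'|-I)(I-2P)$, prepare $t^{-1/2}\sum_{j<t}|j\rangle|\psi'\rangle$, apply $|j\rangle|\chi\rangle\mapsto|j\rangle Q^j|\chi\rangle$ and then the inverse Fourier transform modulo $t$ on the first register, measure $y\in\{0,\dots,t-1\}$, and output $\sin^2(\pi y/t)$. One amplitude estimation takes one copy of $|\psi\rangle$ and $t$ controlled uses of $U$. *Algorithm 2* (outputs $\ge 0$; accuracy $0<\epsilon<1/2$). Let $\mathcal A_{p,q}$ output $v(\mathcal A)$ if $p\le v(\mathcal A)<q$ and $0$ otherwise. Put $K_\epsilon=\lceil\log_2(1/\epsilon)\rceil$, $t_0=\lceil D\sqrt{\log_2(1/\epsilon)}/\epsilon\rceil$. Let $\widetilde\mu_0$ be the output of Algorithm 1 for $\mathcal A_{0,1}$ with $t=t_0$, $\delta=1/10$, and for $1\le\ell\le K_\epsilon$ let $\widetilde\mu_\ell$ be its output for $\mathcal A_{2^{\ell-1},2^\ell}/2^\ell$ with $t=t_0$, $\delta=1/(10K_\epsilon)$. Output $\widetilde\mu_0+\sum_{\ell=1}^{K_\epsilon}2^\ell\widetilde\mu_\ell$.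 *Algorithm 3* ($\sigma$ and $0<\epsilon<4\sigma$). Run $\mathcal A/\sigma$ once (measuring one copy of $|\psi\rangle$) and let $\widetilde m$ be the output. Let $\mathcal B$ be the algorithm that outputs $v(\mathcal A)/\sigma-\widetilde m$, let $\mathcal B_{<0}$ output $\min(v(\mathcal B),0)$ and $\mathcal B_{\ge0}$ output $\max(v(\mathcal B),0)$. Apply Algorithm 2 with accuracy $\epsilon/(32\sigma)$, powered with parameter $1/9$, to $-\mathcal B_{<0}/4$ and to $\mathcal B_{\ge0}/4$; let the results be $\widetilde\mu^-$ and $\widetilde\mu^+$. Output $\sigma(\widetilde m-4\widetilde\mu^-+4\widetilde\mu^+)$. **Theorem.** The universal constants $D,c>0$ can be chosen so that the following holds for a universal constant $K>0$. Let $\mathcal A$ be any algorithm as above with $\mathrm{Var}(v(\mathcal A))\le\sigma^2$, let $0<\epsilon<4\sigma$, and put $x=\max(\sigma/\epsilon,3)$. Then Algorithm 3 1. uses at most $K\,\ln(x)\,\ln\ln(x)$ copies of $|\psi\rangle$, 2. uses $U$ at most $K\,(\sigma/\epsilon)\,\ln^{3/2}(x)\,\ln\ln(x)$ times, whatever the measurement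 outcomes, and 3. with probability at least $2/3$ its output $\widetilde\mu$ satisfies $|\widetilde\mu-\mathbb E[v(\mathcal A)]|\le\epsilon$. In particular it uses $O(\log(\sigma/\epsilon)\log\log(\sigma/\epsilon))$ copies of $|\psi\rangle$ and $O((\sigma/\epsilon)\log^{3/2}(\sigma/\epsilon)\log\log(\sigma/\epsilon))$ applications of $U$. -/

import Mathlib

open scoped Matrix Kronecker

noncomputable section

namespace QMean

/-- Bit strings of length `n`: the computational basis of an `n`-qubit register. -/
abbrev Bits (n : ℕ) : Type := Fin n → Bool

/-! ### The algorithms whose mean output is to be estimated -/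

/-- A quantum algorithm without input: apply a unitary to `|0ⁿ⟩`, measure the `k` qubits
`qubits 0, …, qubits (k-1)` in the computational basis, and output `φ x` on outcome `x`. -/
structure QAlg (n k : ℕ) where
  unitary : Matrix.unitaryGroup (Bits n) ℂ
  qubits : Fin k ↪ Fin n
  φ : Bits k → ℝ

namespace QAlg

variable {n k : ℕ} (A : QAlg n k)

/-- The state `|ψ⟩ = 𝒜|0ⁿ⟩`. -/
def state : Bits n → ℂ := (A.unitary : Matrix (Bits n) (Bits n) ℂ) *ᵥ Pi.single (fun _ => false) 1

/-- The probability that the measurement of the `k` qubits returns `x`. -/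
def outcomeProb (x : Bits k) : ℝ :=
  ∑ z : Bits n, if (fun i => z (A.qubits i)) = x then ‖A.state z‖ ^ 2 else 0

/-- `𝔼[v(𝒜)]`. -/
def mean : ℝ := ∑ x, A.outcomeProb x * A.φ x

/-- `Var(v(𝒜)) = 𝔼[(v(𝒜) - 𝔼[v(𝒜)])²]`. -/
def variance : ℝ := ∑ x, A.outcomeProb x * (A.φ x - A.mean) ^ 2

end QAlg

/-! ### Quantum programs with black-box access to `|ψ⟩` and to `U = 2|ψ⟩⟨ψ| - I` -/

/-- The reflection `U = 2|ψ⟩⟨ψ| - I`. -/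
def reflection {n : ℕ} (ψ : Bits n → ℂ) : Matrix (Bits n) (Bits n) ℂ :=
  (2 : ℂ) • Matrix.vecMulVec ψ (star ψ) - 1

/-- A gate on the joint space of a workspace with basis `W` and an `n`-qubit register: either a
fixed unitary, chosen without knowledge of `ψ`, or one use of `U` on the register, controlled on the
basis state `w` of the workspace satisfying `c w`. -/
inductive Gate (W : Type) [Fintype W] [DecidableEq W] (n : ℕ) : Type
  | fixed (G : Matrix.unitaryGroup (W × Bits n) ℂ) : Gate W n
  | reflect (c : W → Bool) : Gate W n

namespace Gate

variable {W : Type} [Fintype W] [DecidableEq W] {n : ℕ}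

/-- The action of a gate on state vectors. -/
def apply (ψ : Bits n → ℂ) : Gate W n → (W × Bits n → ℂ) → (W × Bits n → ℂ)
  | fixed G, s => (G : Matrix (W × Bits n) (W × Bits n) ℂ) *ᵥ s
  | reflect c, s => fun p => if c p.1 then (reflection ψ *ᵥ fun z => s (p.1, z)) p.2 else s p

/-- The number of uses of `U` made by a gate. -/
def uses : Gate W n → ℕ
  | fixed _ => 0
  | reflect _ => 1

end Gate

/-- The state obtained from `|w₀⟩|ψ⟩` by applying the gates of the list in order. -/
def finalState {W : Type} [Fintype W] [DecidableEq W] {n : ℕ} (ψ : Bits n → ℂ) (w₀ : W)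
    (gates : List (Gate W n)) : W × Bits n → ℂ :=
  gates.foldl (fun s g => g.apply ψ s) (fun p => if p.1 = w₀ then ψ p.2 else 0)

/-- Programs with access to copies of an unknown `n`-qubit state `|ψ⟩` and to the unitary `U`, with
outputs in `α`. The step `run W w₀ gates next` takes one copy of `|ψ⟩`, joins a workspace in the
basis state `|w₀⟩`, applies the gates, measures everything in the computational basis, and goes on
with the program that `next` assigns to the outcome. A program does not depend on `ψ`. -/
inductive Prog (n : ℕ) (α : Type) : Type 1
  | ret (a : α) : Prog n α
  | run (W : Type) [Fintype W] [DecidableEq W] (w₀ : W) (gates : List (Gate W n))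
      (next : W × Bits n → Prog n α) : Prog n α

namespace Prog

variable {n : ℕ} {α β : Type}

/-- Sequential composition. -/
def andThen : Prog n α → (α → Prog n β) → Prog n β
  | ret a, f => f a
  | run W w₀ gates next, f => run W w₀ gates fun o => (next o).andThen f

instance : Monad (Prog n) where
  pure := ret
  bind := andThen

/-- The probability (by the Born rule) that the output of the program lies in `S`. -/
def prob (ψ : Bits n → ℂ) (S : Set α) : Prog n α → ℝ
  | ret a => S.indicator 1 a
  | run _ w₀ gates next => ∑ o, ‖finalState ψ w₀ gates o‖ ^ 2 * (next o).prob ψ S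

/-- The number of copies of `|ψ⟩` used, in the worst case over all measurement outcomes. -/
def copies : Prog n α → ℕ
  | ret _ => 0
  | run _ _ _ next => 1 + Finset.univ.sup fun o => (next o).copies

/-- The number of uses of `U`, in the worst case over all measurement outcomes. -/
def uses : Prog n α → ℕ
  | ret _ => 0
  | run _ _ gates next => (gates.map Gate.uses).sum + Finset.univ.sup fun o => (next o).uses

/-- Run a program `r` times independently and list the outputs. -/
def repeated (p : Prog n α) : ℕ → Prog n (List α)
  | 0 => pure []
  | r + 1 => do
    let a ← p
    let l ← p.repeated r
    pure (a :: l)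

end Prog

/-- A median of a nonempty list of real numbers: entry number `⌊length / 2⌋`, counted from `0`,
of the list sorted in increasing order. -/
def median (l : List ℝ) : ℝ := (l.insertionSort (· ≤ ·)).getD (l.length / 2) 0

/-- The median of `⌈c log (1/δ)⌉` independent runs. -/
def powered {n : ℕ} (c δ : ℝ) (p : Prog n ℝ) : Prog n ℝ := do
  let l ← p.repeated ⌈c * Real.log (1 / δ)⌉₊
  pure (median l)

/-! ### Fixed gates of amplitude estimation

The workspace is `Fin t × Bool`: a phase register with basis `0, …, t-1`, and one extra qubit. -/

/-- The quantum Fourier transform `|j⟩ ↦ t^{-1/2} ∑ y, exp (2πijy/t) |y⟩`. -/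
def qftMatrix (t : ℕ) : Matrix (Fin t) (Fin t) ℂ :=
  Matrix.of fun y j => Complex.exp (2 * Real.pi * Complex.I * (j : ℕ) * (y : ℕ) / t) / √(t : ℝ)

theorem qftMatrix_mem (t : ℕ) : qftMatrix t ∈ Matrix.unitaryGroup (Fin t) ℂ := by
  rw [Matrix.mem_unitaryGroup_iff']
  ext a b
  have ht : 0 < t := a.pos
  have htc : (t : ℂ) ≠ 0 := by exact_mod_cast ht.ne'
  have hprim := Complex.isPrimitiveRoot_exp t ht.ne'
  have hterm : ∀ y : Fin t, star (qftMatrix t y a) * qftMatrix t y b =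
      (Complex.exp (2 * Real.pi * Complex.I * ((b : ℕ) - (a : ℕ)) / t)) ^ (y : ℕ) / t := by
    intro y
    have hs : ((√(t : ℝ) : ℝ) : ℂ) * ((√(t : ℝ) : ℝ) : ℂ) = t := by
      rw [← Complex.ofReal_mul, Real.mul_self_sqrt (Nat.cast_nonneg t)]
      simp
    simp only [qftMatrix, Matrix.of_apply, star_div₀, Complex.star_def, Complex.conj_ofReal]
    rw [div_mul_div_comm, hs, ← Complex.exp_conj, ← Complex.exp_add, ← Complex.exp_nat_mul]
    congr 2
    simp only [map_div₀, map_mul, Complex.conj_ofReal, Complex.conj_I, map_natCast, map_ofNat]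
    ring
  rw [Matrix.mul_apply]
  simp only [Matrix.star_apply]
  rw [Finset.sum_congr rfl fun y _ => hterm y,
    Fin.sum_univ_eq_sum_range
      (fun y => (Complex.exp (2 * Real.pi * Complex.I * ((b : ℕ) - (a : ℕ)) / t)) ^ y / (t : ℂ)) t,
    ← Finset.sum_div]
  by_cases hab : a = b
  · subst hab
    simp [htc]
  · rw [Matrix.one_apply_ne hab, geom_sum_eq]
    · rw [← Complex.exp_nat_mul]
      have h1 : (t : ℂ) * (2 * Real.pi * Complex.I * ((b : ℕ) - (a : ℕ)) / t) =
          (((b : ℕ) : ℤ) - ((a : ℕ) : ℤ) : ℤ) * (2 * Real.pi * Complex.I) := by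
        push_cast
        field_simp
      rw [h1, Complex.exp_int_mul_two_pi_mul_I]
      simp
    · intro h
      apply hab
      have h2 : 2 * Real.pi * Complex.I * ((b : ℕ) - (a : ℕ)) / t =
          2 * Real.pi * Complex.I / t * (b : ℕ) - 2 * Real.pi * Complex.I / t * (a : ℕ) := by
        ring
      rw [h2, Complex.exp_sub, div_eq_one_iff_eq (Complex.exp_ne_zero _)] at h
      have h3 : ∀ j : ℕ, Complex.exp (2 * Real.pi * Complex.I / t * j) =
          Complex.exp (2 * Real.pi * Complex.I / t) ^ j := by
        intro j
        rw [← Complex.exp_nat_mul, mul_comm]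
      rw [h3, h3] at h
      exact Fin.ext (hprim.pow_inj a.isLt b.isLt h.symm)

/-- The rotation `|0⟩ ↦ √(1-p)|0⟩ + √p|1⟩`, `|1⟩ ↦ -√p|0⟩ + √(1-p)|1⟩` (column `b` is the image
of `|b⟩`; `false` is `0` and `true` is `1`). -/
def rotMatrix (p : ℝ) : Matrix Bool Bool ℂ :=
  Matrix.of fun b' b =>
    match b', b with
    | false, false => (√(1 - p) : ℝ)
    | true, false => (√p : ℝ)
    | false, true => -(√p : ℝ)
    | true, true => (√(1 - p) : ℝ)

theorem rotMatrix_mem (p : unitInterval) : rotMatrix p ∈ Matrix.unitaryGroup Bool ℂ := by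
  have h0 : ((√(p : ℝ) : ℝ) : ℂ) * ((√(p : ℝ) : ℝ) : ℂ) = ((p : ℝ) : ℂ) := by
    rw [← Complex.ofReal_mul, Real.mul_self_sqrt p.2.1]
  have h1 : ((√(1 - (p : ℝ)) : ℝ) : ℂ) * ((√(1 - (p : ℝ)) : ℝ) : ℂ) = 1 - ((p : ℝ) : ℂ) := by
    rw [← Complex.ofReal_mul, Real.mul_self_sqrt (by linarith [p.2.2])]
    simp
  rw [Matrix.mem_unitaryGroup_iff]
  ext a b
  rw [Matrix.mul_apply, Fintype.sum_bool]
  cases a <;> cases b <;>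
    simp only [rotMatrix, Matrix.star_apply, Matrix.of_apply, Complex.star_def, map_neg,
      Complex.conj_ofReal, Matrix.one_apply, if_true, reduceCtorEq, if_false] <;>
    first
    | linear_combination h0 + h1
    | ring

variable {n k : ℕ}

/-- The Fourier transform of the phase register. -/
def qftGate (t : ℕ) (n : ℕ) : Matrix.unitaryGroup ((Fin t × Bool) × Bits n) ℂ :=
  ⟨(qftMatrix t ⊗ₖ (1 : Matrix Bool Bool ℂ)) ⊗ₖ (1 : Matrix (Bits n) (Bits n) ℂ),
    Matrix.kronecker_mem_unitary
      (Matrix.kronecker_mem_unitary (qftMatrix_mem t) (one_mem _)) (one_mem _)⟩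

/-- The gate `W`: `|x⟩|0⟩ ↦ |x⟩(√(1-f x)|0⟩ + √(f x)|1⟩)` on the measured qubits and the extra
qubit. -/
def wGate (t : ℕ) (q : Fin k ↪ Fin n) (f : Bits k → unitInterval) :
    Matrix.unitaryGroup ((Fin t × Bool) × Bits n) ℂ :=
  ⟨Matrix.blockDiagonal fun z : Bits n =>
      (1 : Matrix (Fin t) (Fin t) ℂ) ⊗ₖ rotMatrix (f fun i => z (q i)), by
    rw [Matrix.mem_unitaryGroup_iff, Matrix.star_eq_conjTranspose,
      Matrix.blockDiagonal_conjTranspose, ← Matrix.blockDiagonal_mul, ← Matrix.blockDiagonal_one]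
    congr 1
    ext1 z
    exact Matrix.mem_unitaryGroup_iff.1
      (Matrix.kronecker_mem_unitary (one_mem _) (rotMatrix_mem _))⟩

/-- The sign `-1` on the workspace basis states satisfying `c`. -/
def signGate (t : ℕ) (n : ℕ) (c : Fin t × Bool → Bool) :
    Matrix.unitaryGroup ((Fin t × Bool) × Bits n) ℂ :=
  ⟨Matrix.diagonal fun p => if c p.1 then -1 else 1, by
    rw [Matrix.mem_unitaryGroup_iff, Matrix.star_eq_conjTranspose, Matrix.diagonal_conjTranspose,
      Matrix.diagonal_mul_diagonal, ← Matrix.diagonal_one]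
    congr 1
    ext p
    by_cases h : c p.1 <;> simp [h]⟩

/-! ### The estimation algorithms -/

/-- One application of `Q = U' V`, controlled on the phase register `j` satisfying `i < j`. Here
`V = I - 2P` with `P = I ⊗ |1⟩⟨1|`, and `U' = 2|ψ'⟩⟨ψ'| - I` with `|ψ'⟩ = W|ψ⟩|0⟩`. The latter is
`W (2 |ψ⟩⟨ψ| ⊗ |0⟩⟨0| - I) W⁻¹`, where the middle factor is `U` if the extra qubit is `|0⟩`, and is
`-I` if it is `|1⟩`. -/
def groverGates (t : ℕ) (q : Fin k ↪ Fin n) (f : Bits k → unitInterval) (i : ℕ) :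
    List (Gate (Fin t × Bool) n) :=
  [.fixed (signGate t n fun w => decide (i < (w.1 : ℕ)) && w.2),
   .fixed (wGate t q f)⁻¹,
   .reflect fun w => decide (i < (w.1 : ℕ)) && !w.2,
   .fixed (signGate t n fun w => decide (i < (w.1 : ℕ)) && w.2),
   .fixed (wGate t q f)]

/-- The circuit of amplitude estimation with `t` iterations, for `|ψ'⟩ = W|ψ⟩|0⟩` and
`P = I ⊗ |1⟩⟨1|`: Fourier transform of the phase register, `|j⟩|χ⟩ ↦ |j⟩ Q^j |χ⟩`, inverse Fourier
transform. -/
def ampEstGates (t : ℕ) (q : Fin k ↪ Fin n) (f : Bits k → unitInterval) :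
    List (Gate (Fin t × Bool) n) :=
  [.fixed (qftGate t n), .fixed (wGate t q f)] ++
    (List.range t).flatMap (groverGates t q f) ++ [.fixed (qftGate t n)⁻¹]

/-- Amplitude estimation with `t` iterations: measure the phase register after the circuit, and
output `sin² (πy/t)` on outcome `y`. -/
def ampEst (t : ℕ+) (q : Fin k ↪ Fin n) (f : Bits k → unitInterval) : Prog n ℝ :=
  .run (Fin t × Bool) (0, false) (ampEstGates t q f) fun o =>
    pure (Real.sin (Real.pi * ((o.1.1 : ℕ) : ℝ) / t) ^ 2)

/-- Mean estimation for outputs in `[0,1]`, with `t` iterations and failure probability `δ`; `c` is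
the constant in the number `O(log (1/δ))` of repetitions. -/
def meanBounded (c : ℝ) (q : Fin k ↪ Fin n) (f : Bits k → unitInterval) (t : ℕ+) (δ : ℝ) :
    Prog n ℝ :=
  powered c δ (ampEst t q f)

/-- The output function of `𝒜_{p,r} / r`, where `𝒜_{p,r}` outputs `v(𝒜)` if `p ≤ v(𝒜) < r` and `0`
otherwise. -/
def slice (f : Bits k → ℝ) (p r : ℝ) (hp : 0 ≤ p) : Bits k → unitInterval := fun x =>
  ⟨(if p ≤ f x ∧ f x < r then f x else 0) / r, by
    split_ifs with h
    · have hr : 0 < r := (hp.trans h.1).trans_lt h.2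
      exact ⟨div_nonneg (hp.trans h.1) hr.le, (div_le_one hr).2 h.2.le⟩
    · simp⟩

/-- The number `t₀ = ⌈D √(log₂ (1/ε)) / ε⌉` (which is positive if `D > 0` and `0 < ε < 1`). -/
def iterations (D ε : ℝ) : ℕ+ := (⌈D * √(Real.logb 2 (1 / ε)) / ε⌉₊).toPNat'

/-- The sum over `ℓ = 1, …, m` of `2^ℓ` times an estimate of `𝔼[v(𝒜_{2^{ℓ-1},2^ℓ}) / 2^ℓ]`. -/
def sliceSum (c : ℝ) (q : Fin k ↪ Fin n) (f : Bits k → ℝ) (t : ℕ+) (δ : ℝ) : ℕ → Prog n ℝ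
  | 0 => pure 0
  | m + 1 => do
    let s ← sliceSum c q f t δ m
    let μ ← meanBounded c q (slice f (2 ^ m) (2 ^ (m + 1)) (by positivity)) t δ
    pure (s + 2 ^ (m + 1) * μ)

/-- Mean estimation for non-negative outputs with bounded `ℓ₂` norm, with accuracy `ε < 1/2`; `D` is
the constant in the number of iterations. -/
def meanL2 (D c : ℝ) (q : Fin k ↪ Fin n) (f : Bits k → ℝ) (ε : ℝ) : Prog n ℝ := do
  let μ₀ ← meanBounded c q (slice f 0 1 le_rfl) (iterations D ε) (1 / 10)
  let s ← sliceSum c q f (iterations D ε) (1 / (10 * ⌈Real.logb 2 (1 / ε)⌉₊))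
    ⌈Real.logb 2 (1 / ε)⌉₊
  pure (μ₀ + s)

/-- One run of the algorithm: prepare `|ψ⟩`, measure it, and output `f x` if the `k` qubits are
found in state `x`. -/
def sample (q : Fin k ↪ Fin n) (f : Bits k → ℝ) : Prog n ℝ :=
  .run Unit () [] fun o => pure (f fun i => o.2 (q i))

/-- Mean estimation for outputs with variance at most `σ²`, with accuracy `ε < 4σ`. With
`v(ℬ) = v(𝒜)/σ - m`, the two calls are for `-ℬ_{<0}/4` and `ℬ_{≥0}/4`, with failure probability
`1/9` by taking medians. -/
def meanVariance (D c : ℝ) (q : Fin k ↪ Fin n) (φ : Bits k → ℝ) (σ ε : ℝ) : Prog n ℝ := do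
  let m ← sample q fun x => φ x / σ
  let μneg ← powered c (1 / 9)
    (meanL2 D c q (fun x => -(if φ x / σ - m < 0 then φ x / σ - m else 0) / 4) (ε / (32 * σ)))
  let μpos ← powered c (1 / 9)
    (meanL2 D c q (fun x => (if 0 ≤ φ x / σ - m then φ x / σ - m else 0) / 4) (ε / (32 * σ)))
  pure (σ * (m - 4 * μneg + 4 * μpos))

end QMean

end

namespace QMean

/-! ### Norms of state vectors -/

/-! The core is one estimate: an amplitude estimation with t steps for a [0,1]-valued output of mean
p errs by more than 160√p/t + 6400/t² with probability at most 1/5 (`prob_ampEst_le`). The operator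
Q preserves the span of (I-P)ψ' and Pψ' and acts there as the rotation by 2θ, where p = sin²θ
(`foldl_groverGates`, `groverCoeff_eq`). Hence the phase register has the equal mixture of the
phase-estimation distributions for θ and -θ (`norm_sq_groverCoeff`). Their tails are bounded by an
averaging argument, without locating grid points. With S_k = ∑_{j<k} z^j and |z| = 1 far from 1,
M|S_t|² is at most 4 ∑_{k≤M} |S_k|², while Parseval gives ∑_y |S_k|² = tk for every k ≤ t. Taking M
≈ t/20 bounds the tail by t²/5 (`sum_tail_phase_le`).

A failure probability of 1/5 is below 1/2, so medians reduce it exponentially; this follows from the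
exponential moment of the number of bad runs (`prob_powered_le`).

For nonnegative outputs with second moment at most 1, cut the values into about log(1/ε) dyadic
slices. Because the error scales with √p, the slice errors add up to about (1/t) ∑ 2^ℓ √p_ℓ. Since ∑
4^ℓ p_ℓ ≤ 2, Cauchy–Schwarz bounds this by a multiple of √log(1/ε)/t, which explains the choice of
t₀ (`sum_slice_error_le`). Values of at least 1/ε contribute at most ε to the mean
(`prob_meanL2_le`).

For variance at most σ², one sample lies within 3σ of the mean with probability 8/9. After rescaling
and recentring there, the second moment is at most 10 < 16, so the two signed parts divided by 4
fall under the previous case (`prob_meanVariance_le`). Three failures of probability 1/9 leave 2/3.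

Each amplitude estimation costs one copy and t₀ reflections. Their number is O(log x log log x), the
second factor coming from the failure probability 1/(10K_ε) required of each slice
(`exists_resource_bound`). -/

theorem sum_norm_sq_mulVec {ι : Type*} [Fintype ι] [DecidableEq ι] {G : Matrix ι ι ℂ}
    (hG : G ∈ Matrix.unitaryGroup ι ℂ) (s : ι → ℂ) :
    ∑ i, ‖(G *ᵥ s) i‖ ^ 2 = ∑ i, ‖s i‖ ^ 2 := by
  have key : ∀ v : ι → ℂ, ((∑ i, ‖v i‖ ^ 2 : ℝ) : ℂ) = star v ⬝ᵥ v := by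
    intro v
    simp [dotProduct, Complex.conj_mul']
  have h : star (G *ᵥ s) ⬝ᵥ (G *ᵥ s) = star s ⬝ᵥ s := by
    rw [Matrix.star_mulVec, Matrix.dotProduct_mulVec, Matrix.vecMul_vecMul,
      ← Matrix.star_eq_conjTranspose, Matrix.mem_unitaryGroup_iff'.1 hG, Matrix.vecMul_one]
  rw [← key, ← key] at h
  exact_mod_cast h

theorem reflection_mem {n : ℕ} {ψ : Bits n → ℂ} (hψ : ∑ z, ‖ψ z‖ ^ 2 = 1) :
    reflection ψ ∈ Matrix.unitaryGroup (Bits n) ℂ := by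
  have h1 : star ψ ⬝ᵥ ψ = 1 := by
    have : ((∑ z, ‖ψ z‖ ^ 2 : ℝ) : ℂ) = 1 := by rw [hψ]; simp
    rw [← this]
    simp [dotProduct, Complex.conj_mul']
  have h2 : Matrix.vecMulVec ψ (star ψ) * Matrix.vecMulVec ψ (star ψ) =
      Matrix.vecMulVec ψ (star ψ) := by
    rw [Matrix.vecMulVec_mul_vecMulVec, h1, one_smul]
  have h3 : star (reflection ψ) = reflection ψ := by
    simp [reflection, Matrix.star_eq_conjTranspose, Matrix.conjTranspose_vecMulVec]
  rw [Matrix.mem_unitaryGroup_iff, h3, reflection]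
  simp only [sub_mul, mul_sub, smul_mul_smul_comm, h2, mul_one, one_mul]
  module

theorem Gate.sum_norm_sq_apply {W : Type} [Fintype W] [DecidableEq W] {n : ℕ} {ψ : Bits n → ℂ}
    (hψ : ∑ z, ‖ψ z‖ ^ 2 = 1) (g : Gate W n) (s : W × Bits n → ℂ) :
    ∑ p, ‖g.apply ψ s p‖ ^ 2 = ∑ p, ‖s p‖ ^ 2 := by
  cases g with
  | fixed G => exact sum_norm_sq_mulVec G.2 s
  | reflect c =>
    rw [Fintype.sum_prod_type, Fintype.sum_prod_type]
    refine Finset.sum_congr rfl fun w _ => ?_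
    by_cases h : c w
    · simp only [Gate.apply, h, if_true]
      exact sum_norm_sq_mulVec (reflection_mem hψ) _
    · simp [Gate.apply, h]

theorem sum_norm_sq_foldl {W : Type} [Fintype W] [DecidableEq W] {n : ℕ} {ψ : Bits n → ℂ}
    (hψ : ∑ z, ‖ψ z‖ ^ 2 = 1) (gates : List (Gate W n)) (s : W × Bits n → ℂ) :
    ∑ p, ‖gates.foldl (fun s g => g.apply ψ s) s p‖ ^ 2 = ∑ p, ‖s p‖ ^ 2 := by
  induction gates generalizing s with
  | nil => rfl
  | cons g l ih => rw [List.foldl_cons, ih, g.sum_norm_sq_apply hψ]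

theorem sum_norm_sq_finalState {W : Type} [Fintype W] [DecidableEq W] {n : ℕ} {ψ : Bits n → ℂ}
    (hψ : ∑ z, ‖ψ z‖ ^ 2 = 1) (w₀ : W) (gates : List (Gate W n)) :
    ∑ p, ‖finalState ψ w₀ gates p‖ ^ 2 = 1 := by
  rw [finalState, sum_norm_sq_foldl hψ, Fintype.sum_prod_type, Finset.sum_eq_single w₀]
  · simpa using hψ
  · intro w _ h
    simp [h]
  · simp

/-! ### Expectations -/

namespace Prog

variable {n : ℕ} {α β : Type} {ψ : Bits n → ℂ}

/-- The expectation of `g` at the output of the program. -/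
noncomputable def expect (ψ : Bits n → ℂ) (g : α → ℝ) : Prog n α → ℝ
  | ret a => g a
  | run _ w₀ gates next => ∑ o, ‖finalState ψ w₀ gates o‖ ^ 2 * (next o).expect ψ g

theorem prob_eq_expect (S : Set α) (p : Prog n α) :
    p.prob ψ S = p.expect ψ (S.indicator 1) := by
  induction p with
  | ret a => rfl
  | run W w₀ gates next ih => simp only [prob, expect, ih]

@[simp]
theorem expect_pure (g : α → ℝ) (a : α) : (pure a : Prog n α).expect ψ g = g a := rfl

theorem expect_bind (g : β → ℝ) (p : Prog n α) (f : α → Prog n β) :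
    (p >>= f).expect ψ g = p.expect ψ fun a => (f a).expect ψ g := by
  change (p.andThen f).expect ψ g = _
  induction p with
  | ret a => rfl
  | run W w₀ gates next ih => simp only [andThen, expect, ih]

theorem expect_mono {g h : α → ℝ} (hgh : ∀ a, g a ≤ h a) (p : Prog n α) :
    p.expect ψ g ≤ p.expect ψ h := by
  induction p with
  | ret a => exact hgh a
  | run W w₀ gates next ih =>
    simp only [expect]
    gcongr
    exact ih _

theorem expect_add (g h : α → ℝ) (p : Prog n α) :
    (p.expect ψ fun a => g a + h a) = p.expect ψ g + p.expect ψ h := by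
  induction p with
  | ret a => rfl
  | run W w₀ gates next ih => simp only [expect, ih, mul_add, Finset.sum_add_distrib]

theorem expect_const_mul (c : ℝ) (g : α → ℝ) (p : Prog n α) :
    (p.expect ψ fun a => c * g a) = c * p.expect ψ g := by
  induction p with
  | ret a => rfl
  | run W w₀ gates next ih =>
    simp only [expect, ih, Finset.mul_sum]
    exact Finset.sum_congr rfl fun o _ => by ring

theorem expect_const (hψ : ∑ z, ‖ψ z‖ ^ 2 = 1) (c : ℝ) (p : Prog n α) :
    (p.expect ψ fun _ => c) = c := by
  induction p with
  | ret a => rfl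
  | run W w₀ gates next ih =>
    simp only [expect, ih, ← Finset.sum_mul, sum_norm_sq_finalState hψ, one_mul]

theorem prob_compl (hψ : ∑ z, ‖ψ z‖ ^ 2 = 1) (S : Set α) (p : Prog n α) :
    p.prob ψ Sᶜ = 1 - p.prob ψ S := by
  rw [eq_sub_iff_add_eq, prob_eq_expect, prob_eq_expect, ← expect_add]
  refine Eq.trans ?_ (expect_const hψ 1 p)
  congr 1
  ext a
  by_cases h : a ∈ S <;> simp [h]

theorem prob_nonneg (S : Set α) (p : Prog n α) : 0 ≤ p.prob ψ S := by
  induction p with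
  | ret a => exact Set.indicator_nonneg (by simp) a
  | run W w₀ gates next ih =>
    exact Finset.sum_nonneg fun o _ => mul_nonneg (by positivity) (ih o)

theorem prob_le_one (hψ : ∑ z, ‖ψ z‖ ^ 2 = 1) (S : Set α) (p : Prog n α) : p.prob ψ S ≤ 1 := by
  have h := p.prob_compl hψ S
  have h' := p.prob_nonneg (ψ := ψ) Sᶜ
  linarith

@[simp]
theorem prob_pure (S : Set α) (a : α) : (pure a : Prog n α).prob ψ S = S.indicator 1 a := rfl

/-- Failure probabilities add up under sequential composition. -/
theorem prob_bind_le (hψ : ∑ z, ‖ψ z‖ ^ 2 = 1) {p : Prog n α} {f : α → Prog n β}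
    {T : Set α} {S : Set β} {a b : ℝ} (hp : p.prob ψ Tᶜ ≤ a)
    (hf : ∀ x ∈ T, (f x).prob ψ S ≤ b) (hb : 0 ≤ b) :
    (p >>= f).prob ψ S ≤ a + b := by
  rw [prob_eq_expect, expect_bind]
  calc _ ≤ p.expect ψ fun x => Tᶜ.indicator 1 x + b := by
        refine expect_mono (fun x => ?_) p
        rw [← prob_eq_expect]
        by_cases hx : x ∈ T
        · simpa [hx] using hf x hx
        · simpa [hx] using ((f x).prob_le_one hψ S).trans (by linarith)
    _ = p.prob ψ Tᶜ + b := by rw [expect_add, expect_const hψ, prob_eq_expect]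
    _ ≤ a + b := by gcongr

/-! ### Resources -/

/-- Costs are suprema over outcomes, so the bound on the continuation has to be uniform in the
intermediate value. -/
theorem copies_bind_le {p : Prog n α} {f : α → Prog n β} {a b : ℕ} (hp : p.copies ≤ a)
    (hf : ∀ x, (f x).copies ≤ b) : (p >>= f).copies ≤ a + b := by
  have : (p >>= f).copies ≤ p.copies + b := by
    change (p.andThen f).copies ≤ _
    clear hp
    induction p with
    | ret a => exact (hf a).trans (Nat.le_add_left _ _)
    | run W w₀ gates next ih =>
      simp only [andThen, copies]
      rw [add_assoc]
      gcongr
      refine Finset.sup_le fun o ho => (ih o).trans ?_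
      gcongr
      exact Finset.le_sup (f := fun o => (next o).copies) ho
  omega

theorem uses_bind_le {p : Prog n α} {f : α → Prog n β} {a b : ℕ} (hp : p.uses ≤ a)
    (hf : ∀ x, (f x).uses ≤ b) : (p >>= f).uses ≤ a + b := by
  have : (p >>= f).uses ≤ p.uses + b := by
    change (p.andThen f).uses ≤ _
    clear hp
    induction p with
    | ret a => exact (hf a).trans (Nat.le_add_left _ _)
    | run W w₀ gates next ih =>
      simp only [andThen, uses]
      rw [add_assoc]
      gcongr
      refine Finset.sup_le fun o ho => (ih o).trans ?_
      gcongr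
      exact Finset.le_sup (f := fun o => (next o).uses) ho
  omega

@[simp]
theorem copies_pure (a : α) : (pure a : Prog n α).copies = 0 := rfl

@[simp]
theorem uses_pure (a : α) : (pure a : Prog n α).uses = 0 := rfl

theorem copies_repeated_le {p : Prog n α} {a : ℕ} (hp : p.copies ≤ a) (r : ℕ) :
    (p.repeated r).copies ≤ r * a := by
  induction r with
  | zero => simp [repeated]
  | succ r ih =>
    rw [Nat.succ_mul, add_comm (r * a)]
    exact copies_bind_le hp fun x => copies_bind_le ih fun l => (copies_pure _).le

theorem uses_repeated_le {p : Prog n α} {a : ℕ} (hp : p.uses ≤ a) (r : ℕ) :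
    (p.repeated r).uses ≤ r * a := by
  induction r with
  | zero => simp [repeated]
  | succ r ih =>
    rw [Nat.succ_mul, add_comm (r * a)]
    exact uses_bind_le hp fun x => uses_bind_le ih fun l => (uses_pure _).le

/-- The exponential moment of the number of outputs outside `S` in independent runs. -/
theorem expect_repeated_le (hψ : ∑ z, ‖ψ z‖ ^ 2 = 1) {p : Prog n α} {S : Set α}
    [DecidablePred (· ∉ S)] {a : ℝ} (hp : p.prob ψ Sᶜ ≤ a) (ha : 0 ≤ a) (r : ℕ) :
    ((p.repeated r).expect ψ fun l => (2 : ℝ) ^ l.countP (· ∉ S)) ≤ (1 + a) ^ r := by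
  induction r with
  | zero => simp [repeated]
  | succ r ih =>
    -- Each bad output doubles the power, so the expectation factorises over the runs, with factor 1
    -- + P(bad) per run.
    have hcons : ∀ (x : α) (l : List α), (2 : ℝ) ^ (x :: l).countP (· ∉ S) =
        (1 + Sᶜ.indicator 1 x) * 2 ^ l.countP (· ∉ S) := by
      intro x l
      by_cases hx : x ∈ S
      · simp [hx]
      · simp [hx, pow_succ]; ring
    simp only [repeated, expect_bind, expect_pure, hcons, expect_const_mul]
    have h0 : 0 ≤ (p.repeated r).expect ψ fun l => (2 : ℝ) ^ l.countP (· ∉ S) := by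
      rw [← expect_const hψ 0 (p.repeated r)]
      exact expect_mono (fun l => by positivity) _
    calc (p.expect ψ fun x => (1 + Sᶜ.indicator 1 x) *
            (p.repeated r).expect ψ fun l => (2 : ℝ) ^ l.countP (· ∉ S))
        = (1 + p.prob ψ Sᶜ) * (p.repeated r).expect ψ fun l => (2 : ℝ) ^ l.countP (· ∉ S) := by
          simp only [mul_comm _ (expect _ _ _), expect_const_mul, expect_add, expect_const hψ,
            prob_eq_expect]
      _ ≤ (1 + a) * (1 + a) ^ r := by gcongr
      _ = _ := by ring

end Prog

/-! ### Medians -/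

/-- If the middle entry of the sorted list is below `a`, so are all entries up to it; if it is above
`b`, so are all entries from it on. Either way at least half of the list is outside the interval. -/
theorem median_mem_Icc {l : List ℝ} {a b : ℝ}
    (h : 2 * l.countP (· ∉ Set.Icc a b) < l.length) : median l ∈ Set.Icc a b := by
  classical
  set s := l.insertionSort (· ≤ ·) with hs
  have hperm : s.Perm l := l.perm_insertionSort _
  have hlen : s.length = l.length := hperm.length_eq
  have hsort : s.Pairwise (· ≤ ·) := l.pairwise_insertionSort _
  have hcount : s.countP (· ∉ Set.Icc a b) = l.countP (· ∉ Set.Icc a b) := hperm.countP_eq _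
  have hlt : l.length / 2 < s.length := by omega
  have hmed : median l = s[l.length / 2] := by
    rw [median, ← hs, List.getD_eq_getElem _ _ hlt]
  rw [hmed]
  by_contra hcon
  rw [Set.mem_Icc, not_and_or, not_le, not_le] at hcon
  rcases hcon with hc | hc
  · have h1 : l.length / 2 + 1 ≤ s.countP (· ∉ Set.Icc a b) := by
      have : (s.take (l.length / 2 + 1)).countP (· ∉ Set.Icc a b) = l.length / 2 + 1 := by
        rw [List.countP_eq_length.2, List.length_take, min_eq_left (by omega)]
        intro x hx
        obtain ⟨i, hi, rfl⟩ := List.mem_iff_getElem.1 hx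
        rw [List.length_take] at hi
        have : s[i] ≤ s[l.length / 2] := hsort.sortedLE.getElem_le_getElem_of_le (by omega)
        simp only [List.getElem_take, decide_eq_true_eq, Set.mem_Icc, not_and_or, not_le]
        left; linarith
      rw [← this]
      exact (List.take_sublist _ _).countP_le
    omega
  · have h1 : s.length - l.length / 2 ≤ s.countP (· ∉ Set.Icc a b) := by
      have : (s.drop (l.length / 2)).countP (· ∉ Set.Icc a b) = s.length - l.length / 2 := by
        rw [List.countP_eq_length.2, List.length_drop]
        intro x hx
        obtain ⟨i, hi, rfl⟩ := List.mem_iff_getElem.1 hx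
        rw [List.length_drop] at hi
        have : s[l.length / 2] ≤ s[l.length / 2 + i] :=
          hsort.sortedLE.getElem_le_getElem_of_le (by omega)
        simp only [List.getElem_drop, decide_eq_true_eq, Set.mem_Icc, not_and_or, not_le]
        right; linarith
      rw [← this]
      exact (List.drop_sublist _ _).countP_le
    omega

/-- Lists of any other length have probability zero. This makes the length available in pointwise
bounds on the median. -/
theorem Prog.expect_repeated_length {n : ℕ} {α : Type} {ψ : Bits n → ℂ} (p : Prog n α) (r : ℕ)
    (g : List α → ℝ) :
    (p.repeated r).expect ψ g = (p.repeated r).expect ψ fun l => if l.length = r then g l else 0 := by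
  induction r generalizing g with
  | zero => simp [repeated]
  | succ r ih =>
    simp only [repeated, expect_bind, expect_pure]
    congr 1
    ext a
    rw [ih]
    nth_rewrite 2 [ih]
    congr 1
    ext l
    by_cases h : l.length = r <;> simp [h]

/-- The median of independent runs. -/
theorem prob_powered_le {n : ℕ} {ψ : Bits n → ℂ} (hψ : ∑ z, ‖ψ z‖ ^ 2 = 1) {p : Prog n ℝ}
    {a b δ : ℝ} (hp : p.prob ψ (Set.Icc a b)ᶜ ≤ 1 / 5) (hδ : 0 < δ) {c : ℝ} (hc : 10 ≤ c)
    (hδ1 : δ ≤ 1) :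
    (powered c δ p).prob ψ (Set.Icc a b)ᶜ ≤ δ := by
  classical
  set r := ⌈c * Real.log (1 / δ)⌉₊ with hr
  have hrle : c * Real.log (1 / δ) ≤ r := Nat.le_ceil _
  have hlog : 0 ≤ Real.log (1 / δ) := Real.log_nonneg (by rw [le_div_iff₀ hδ]; linarith)
  have hmom := Prog.expect_repeated_le hψ hp (by norm_num) r
  -- Markov weight: a median outside the interval forces N bad outputs with 2N ≥ r, hence q^r · 2^N
  -- ≥ 1.
  set q : ℝ := 1 / √2 with hq
  have hq0 : 0 < q := by positivity
  have hq2 : q ^ 2 * 2 = 1 := by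
    rw [hq, div_pow, Real.sq_sqrt (by norm_num)]; norm_num
  have hq1 : q ≤ 5 / 7 := by nlinarith
  have hstep : (powered c δ p).prob ψ (Set.Icc a b)ᶜ ≤ q ^ r * (1 + 1 / 5) ^ r := by
    refine le_trans ?_ (mul_le_mul_of_nonneg_left hmom (by positivity))
    rw [← Prog.expect_const_mul, Prog.prob_eq_expect, powered, Prog.expect_bind,
      ← hr, Prog.expect_repeated_length]
    refine Prog.expect_mono (fun l => ?_) _
    split_ifs with hl
    · rw [Prog.expect_pure]
      by_cases hm : median l ∈ Set.Icc a b
      · rw [Set.indicator_of_notMem (by simpa using hm)]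
        positivity
      · rw [Set.indicator_of_mem (by simpa using hm)]
        have h2 : r ≤ 2 * l.countP (· ∉ Set.Icc a b) := by
          by_contra hcon
          exact hm (median_mem_Icc (by omega))
        have hsq : (1 : ℝ) ≤ (q ^ r * 2 ^ l.countP (· ∉ Set.Icc a b)) ^ 2 := by
          rw [mul_pow, ← pow_mul, ← pow_mul, mul_comm r, pow_mul, mul_comm _ 2]
          have : (2 : ℝ) ^ r ≤ 2 ^ (2 * l.countP (· ∉ Set.Icc a b)) :=
            pow_le_pow_right₀ (by norm_num) h2
          calc (1 : ℝ) = (q ^ 2) ^ r * 2 ^ r := by rw [← mul_pow, hq2, one_pow]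
            _ ≤ _ := by gcongr
        exact (one_le_sq_iff₀ (by positivity)).1 hsq
    · positivity
  refine hstep.trans ?_
  rw [← mul_pow]
  -- 5/7 · 6/5 = 6/7 ≤ e^(-1/7), so any c ≥ 7 would be enough.
  calc (q * (1 + 1 / 5)) ^ r ≤ (6 / 7 : ℝ) ^ r := by gcongr; linarith
    _ ≤ Real.exp (-(1 / 7)) ^ r := by
        gcongr
        have := Real.add_one_le_exp (-(1 / 7 : ℝ))
        linarith
    _ = Real.exp (-(r / 7)) := by rw [← Real.exp_nat_mul]; ring_nf
    _ ≤ Real.exp (-Real.log (1 / δ)) := by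
        gcongr
        nlinarith
    _ = δ := by rw [Real.exp_neg, Real.exp_log (by positivity)]; simp

theorem copies_powered_le {n : ℕ} (c δ : ℝ) {p : Prog n ℝ} {a : ℕ} (hp : p.copies ≤ a) :
    (powered c δ p).copies ≤ ⌈c * Real.log (1 / δ)⌉₊ * a :=
  Prog.copies_bind_le (b := 0) (Prog.copies_repeated_le hp _) fun _ => le_rfl

theorem uses_powered_le {n : ℕ} (c δ : ℝ) {p : Prog n ℝ} {a : ℕ} (hp : p.uses ≤ a) :
    (powered c δ p).uses ≤ ⌈c * Real.log (1 / δ)⌉₊ * a :=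
  Prog.uses_bind_le (b := 0) (Prog.uses_repeated_le hp _) fun _ => le_rfl

/-! ### The circuit of amplitude estimation -/

section Circuit

variable {n k t : ℕ}

theorem Gate.apply_fixed {W : Type} [Fintype W] [DecidableEq W] (ψ : Bits n → ℂ)
    (G : Matrix.unitaryGroup (W × Bits n) ℂ) (s : W × Bits n → ℂ) :
    (Gate.fixed G).apply ψ s = G.1 *ᵥ s := rfl

theorem reflection_mulVec (ψ v : Bits n → ℂ) (z : Bits n) :
    (reflection ψ *ᵥ v) z = 2 * (star ψ ⬝ᵥ v) * ψ z - v z := by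
  rw [reflection, Matrix.sub_mulVec, Matrix.smul_mulVec, Matrix.one_mulVec,
    Matrix.vecMulVec_mulVec]
  simp
  ring

theorem signGate_mulVec (c : Fin t × Bool → Bool) (s : (Fin t × Bool) × Bits n → ℂ)
    (p : (Fin t × Bool) × Bits n) :
    ((signGate t n c : Matrix _ _ ℂ) *ᵥ s) p = (if c p.1 then -1 else 1) * s p := by
  simp [signGate, Matrix.mulVec_diagonal]

theorem wGate_mulVec (q : Fin k ↪ Fin n) (f : Bits k → unitInterval)
    (s : (Fin t × Bool) × Bits n → ℂ) (j : Fin t) (b : Bool) (z : Bits n) :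
    ((wGate t q f : Matrix _ _ ℂ) *ᵥ s) ((j, b), z) =
      ∑ b', rotMatrix (f fun i => z (q i)) b b' * s ((j, b'), z) := by
  simp only [wGate, Matrix.mulVec, dotProduct, Fintype.sum_prod_type]
  simp [Matrix.blockDiagonal_apply, Matrix.one_apply]

theorem inv_wGate_mulVec (q : Fin k ↪ Fin n) (f : Bits k → unitInterval)
    (s : (Fin t × Bool) × Bits n → ℂ) (j : Fin t) (b : Bool) (z : Bits n) :
    (((wGate t q f)⁻¹ : Matrix.unitaryGroup _ ℂ) *ᵥ s) ((j, b), z) =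
      ∑ b', star (rotMatrix (f fun i => z (q i)) b' b) * s ((j, b'), z) := by
  simp only [wGate, Matrix.mulVec, dotProduct, Fintype.sum_prod_type]
  simp [Matrix.blockDiagonal_apply, Matrix.one_apply,
    Matrix.star_apply, apply_ite, Finset.sum_ite_eq, eq_comm]

theorem qftGate_mulVec (s : (Fin t × Bool) × Bits n → ℂ) (j : Fin t) (b : Bool) (z : Bits n) :
    ((qftGate t n : Matrix _ _ ℂ) *ᵥ s) ((j, b), z) = ∑ j', qftMatrix t j j' * s ((j', b), z) := by
  simp only [qftGate, Matrix.mulVec, dotProduct, Fintype.sum_prod_type]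
  simp [Matrix.one_apply]

theorem inv_qftGate_mulVec (s : (Fin t × Bool) × Bits n → ℂ) (j : Fin t) (b : Bool)
    (z : Bits n) :
    (((qftGate t n)⁻¹ : Matrix.unitaryGroup _ ℂ) *ᵥ s) ((j, b), z) =
      ∑ j', star (qftMatrix t j' j) * s ((j', b), z) := by
  simp only [qftGate, Matrix.mulVec, dotProduct, Fintype.sum_prod_type]
  simp [Matrix.one_apply, Matrix.star_apply, apply_ite]

/-- The state `∑ j, |j⟩ (α j (I - P) + β j P) W |ψ⟩|0⟩`. -/
noncomputable def ampState (q : Fin k ↪ Fin n) (f : Bits k → unitInterval) (ψ : Bits n → ℂ)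
    (α β : Fin t → ℂ) : (Fin t × Bool) × Bits n → ℂ := fun p =>
  (if p.1.2 then β p.1.1 * (√(f fun i => p.2 (q i) : ℝ) : ℝ)
    else α p.1.1 * (√(1 - (f fun i => p.2 (q i) : ℝ)) : ℝ)) * ψ p.2

/-- The expectation of `f` at the measured qubits. -/
noncomputable def avg (q : Fin k ↪ Fin n) (ψ : Bits n → ℂ) (f : Bits k → ℝ) : ℝ :=
  ∑ z, ‖ψ z‖ ^ 2 * f fun i => z (q i)

variable {q : Fin k ↪ Fin n} {f : Bits k → unitInterval} {ψ : Bits n → ℂ}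

/-- Between W⁻¹ and W, the part with extra qubit |0⟩ has the form (a + b f)ψ. Its overlap with ψ is
a + bp, so the reflection sees `f` only through its mean and the two-coefficient form is preserved.
-/
theorem foldl_groverGates (hψ : ∑ z, ‖ψ z‖ ^ 2 = 1) {p : ℂ}
    (hp : p = (avg q ψ fun x => f x : ℝ)) (i : ℕ) (α β : Fin t → ℂ) :
    (groverGates t q f i).foldl (fun s g => g.apply ψ s) (ampState q f ψ α β) =
      ampState q f ψ
        (fun j => if i < (j : ℕ) then (1 - 2 * p) * α j - 2 * p * β j else α j)
        (fun j => if i < (j : ℕ) then 2 * (1 - p) * α j + (1 - 2 * p) * β j else β j) := by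
  have hF : ∀ x : Bits k, ((√(f x : ℝ) : ℝ) : ℂ) * ((√(f x : ℝ) : ℝ) : ℂ) = ((f x : ℝ) : ℂ) := by
    intro x
    rw [← Complex.ofReal_mul, Real.mul_self_sqrt (f x).2.1]
  have hG : ∀ x : Bits k,
      ((√(1 - (f x : ℝ)) : ℝ) : ℂ) * ((√(1 - (f x : ℝ)) : ℝ) : ℂ) = 1 - ((f x : ℝ) : ℂ) := by
    intro x
    rw [← Complex.ofReal_mul, Real.mul_self_sqrt (by linarith [(f x).2.2])]
    simp
  have hinner : ∀ a b : ℂ, (star ψ ⬝ᵥ fun z => (a + b * (f fun i => z (q i) : ℝ)) * ψ z) =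
      a + b * p := by
    intro a b
    have h1 : a = ∑ z, a * (‖ψ z‖ : ℂ) ^ 2 := by
      rw [← Finset.mul_sum]
      have : ((∑ z, ‖ψ z‖ ^ 2 : ℝ) : ℂ) = 1 := by rw [hψ]; simp
      push_cast at this
      rw [this, mul_one]
    rw [hp, avg]
    conv_rhs => rw [h1]
    push_cast
    simp only [dotProduct, Finset.mul_sum, ← Finset.sum_add_distrib, Pi.star_apply]
    refine Finset.sum_congr rfl fun z _ => ?_
    rw [← Complex.conj_mul', Complex.star_def]
    ring
  -- the state before the use of `U`
  have h2 : (((wGate t q f)⁻¹ : Matrix.unitaryGroup _ ℂ) : Matrix _ _ ℂ) *ᵥ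
      ((signGate t n fun w => decide (i < (w.1 : ℕ)) && w.2).1 *ᵥ ampState q f ψ α β) =
      fun r : (Fin t × Bool) × Bits n =>
      (if r.1.2 then
        ((if i < (r.1.1 : ℕ) then -β r.1.1 else β r.1.1) - α r.1.1) *
          (√(f fun i => r.2 (q i) : ℝ) : ℝ) * (√(1 - (f fun i => r.2 (q i) : ℝ)) : ℝ)
        else α r.1.1 + ((if i < (r.1.1 : ℕ) then -β r.1.1 else β r.1.1) - α r.1.1) *
          (f fun i => r.2 (q i) : ℝ)) * ψ r.2 := by
    ext ⟨⟨j, b⟩, z⟩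
    have hFz := hF fun i => z (q i)
    have hGz := hG fun i => z (q i)
    rw [inv_wGate_mulVec]
    simp only [signGate_mulVec, ampState, Fintype.sum_bool]
    by_cases hij : i < (j : ℕ) <;> cases b <;>
      simp [rotMatrix, hij]
    · linear_combination -(β j) * ψ z * hFz + α j * ψ z * hGz
    · ring
    · linear_combination (β j) * ψ z * hFz + α j * ψ z * hGz
    · ring
  simp only [groverGates, List.foldl_cons, List.foldl_nil, Gate.apply, h2]
  ext ⟨⟨j, b⟩, z⟩
  have hFz := hF fun i => z (q i)
  have hGz := hG fun i => z (q i)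
  rw [wGate_mulVec]
  simp only [signGate_mulVec, ampState, Fintype.sum_bool]
  by_cases hij : i < (j : ℕ) <;> cases b <;>
    simp [rotMatrix, hij, reflection_mulVec, hinner]
  -- The first two cases are a genuine application of Q. In the last two the branch is inactive, and
  -- W merely cancels W⁻¹.
  · linear_combination (-β j - α j) * (√(1 - (f fun i => z (q i) : ℝ)) : ℝ) * ψ z * hFz
  · linear_combination (β j + α j) * (√(f fun i => z (q i) : ℝ) : ℝ) * ψ z * hGz
  · linear_combination (α j - β j) * (√(1 - (f fun i => z (q i) : ℝ)) : ℝ) * ψ z * hFz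
  · linear_combination (β j - α j) * (√(f fun i => z (q i) : ℝ) : ℝ) * ψ z * hGz

/-- The coefficients of `Q ^ m |χ⟩` with respect to `(I - P) |χ⟩` and `P |χ⟩`, where
`|χ⟩ = W |ψ⟩|0⟩`. -/
noncomputable def groverCoeff (p : ℝ) : ℕ → ℝ × ℝ
  | 0 => (1, 1)
  | m + 1 => ((1 - 2 * p) * (groverCoeff p m).1 - 2 * p * (groverCoeff p m).2,
      2 * (1 - p) * (groverCoeff p m).1 + (1 - 2 * p) * (groverCoeff p m).2)

/-- Step i acts on branch j exactly when i < j, so after m steps the branch has undergone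
Q^min(j,m), which is Q^j once m ≥ j. -/
theorem foldl_range_groverGates (hψ : ∑ z, ‖ψ z‖ ^ 2 = 1) {p : ℝ}
    (hp : p = avg q ψ fun x => f x) (a : ℂ) (m : ℕ) :
    ((List.range m).flatMap (groverGates t q f)).foldl (fun s g => g.apply ψ s)
        (ampState q f ψ (fun _ => a) (fun _ => a)) =
      ampState q f ψ (fun j => a * (groverCoeff p (min j m)).1)
        (fun j => a * (groverCoeff p (min j m)).2) := by
  induction m with
  | zero => simp [groverCoeff]
  | succ m ih =>
    rw [List.range_succ, List.flatMap_append, List.foldl_append, ih, List.flatMap_singleton,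
      foldl_groverGates hψ (p := (p : ℂ)) (by rw [hp])]
    congr 1 <;> ext j <;> by_cases h : m < (j : ℕ)
    · rw [if_pos h, min_eq_right h.le, min_eq_right h, groverCoeff]
      push_cast
      ring
    · rw [if_neg h, min_eq_left (by omega), min_eq_left (by omega)]
    · rw [if_pos h, min_eq_right h.le, min_eq_right h, groverCoeff]
      push_cast
      ring
    · rw [if_neg h, min_eq_left (by omega), min_eq_left (by omega)]

theorem finalState_ampEst [NeZero t] (hψ : ∑ z, ‖ψ z‖ ^ 2 = 1) {p : ℝ}
    (hp : p = avg q ψ fun x => f x) (y : Fin t) (b : Bool) (z : Bits n) :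
    finalState ψ ((0 : Fin t), false) (ampEstGates t q f) ((y, b), z) =
      ∑ j, star (qftMatrix t j y) *
        ampState q f ψ (fun j => 1 / (√(t : ℝ) : ℝ) * (groverCoeff p j).1)
          (fun j => 1 / (√(t : ℝ) : ℝ) * (groverCoeff p j).2) ((j, b), z) := by
  have h1 : ((wGate t q f).1 *ᵥ ((qftGate t n).1 *ᵥ
      fun r : (Fin t × Bool) × Bits n => if r.1 = (0, false) then ψ r.2 else 0)) =
      ampState q f ψ (fun _ => 1 / (√(t : ℝ) : ℝ)) (fun _ => 1 / (√(t : ℝ) : ℝ)) := by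
    ext ⟨⟨j, b⟩, z⟩
    rw [wGate_mulVec]
    simp only [qftGate_mulVec, Fintype.sum_bool, ampState]
    cases b <;> simp [rotMatrix, qftMatrix] <;> ring
  rw [finalState, ampEstGates, List.foldl_append, List.foldl_append]
  simp only [List.foldl_cons, List.foldl_nil, Gate.apply_fixed]
  rw [h1, foldl_range_groverGates hψ hp, inv_qftGate_mulVec]
  refine Finset.sum_congr rfl fun j _ => ?_
  simp only [ampState]
  rw [min_eq_left j.2.le]

/-- The components (I-P)ψ' and Pψ' are told apart by the extra qubit, so there is no cross term;
their squared norms are 1 - p and p. -/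
theorem sum_norm_sq_finalState_ampEst [NeZero t] (hψ : ∑ z, ‖ψ z‖ ^ 2 = 1) {p : ℝ}
    (hp : p = avg q ψ fun x => f x) (y : Fin t) :
    ∑ b, ∑ z, ‖finalState ψ ((0 : Fin t), false) (ampEstGates t q f) ((y, b), z)‖ ^ 2 =
      ‖∑ j : Fin t, star (qftMatrix t j y) * (1 / (√(t : ℝ) : ℝ) * (groverCoeff p j).1)‖ ^ 2 *
          (1 - p) +
        ‖∑ j : Fin t, star (qftMatrix t j y) * (1 / (√(t : ℝ) : ℝ) * (groverCoeff p j).2)‖ ^ 2 *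
          p := by
  have hp' : 1 - p = ∑ z, ‖ψ z‖ ^ 2 * (1 - f fun i => z (q i)) := by
    simp only [mul_sub, Finset.sum_sub_distrib, mul_one, hψ, hp, avg]
  have h0 : ∀ X : ℝ, X * (1 - p) = ∑ z, X * (‖ψ z‖ ^ 2 * (1 - f fun i => z (q i))) := by
    intro X
    rw [hp', Finset.mul_sum]
  have h1 : ∀ X : ℝ, X * p = ∑ z, X * (‖ψ z‖ ^ 2 * f fun i => z (q i)) := by
    intro X
    rw [hp, avg, Finset.mul_sum]
  rw [Fintype.sum_bool, add_comm, h0, h1]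
  simp only [finalState_ampEst hψ hp, ampState, if_true, Bool.false_eq_true, if_false,
    ← mul_assoc, ← Finset.sum_mul, norm_mul, mul_pow, Complex.norm_real, Real.norm_eq_abs, sq_abs]
  congr 1 <;> refine Finset.sum_congr rfl fun z _ => ?_
  · rw [Real.sq_sqrt (by linarith [(f fun i => z (q i)).2.2])]
    ring
  · rw [Real.sq_sqrt (f fun i => z (q i)).2.1]
    ring

theorem prob_ampEst (t : ℕ+) (hψ : ∑ z, ‖ψ z‖ ^ 2 = 1) {p : ℝ}
    (hp : p = avg q ψ fun x => f x) (S : Set ℝ) :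
    (ampEst t q f).prob ψ S = ∑ y : Fin t,
      (‖∑ j : Fin t, star (qftMatrix t j y) * (1 / (√(t : ℝ) : ℝ) * (groverCoeff p j).1)‖ ^ 2 *
          (1 - p) +
        ‖∑ j : Fin t, star (qftMatrix t j y) * (1 / (√(t : ℝ) : ℝ) * (groverCoeff p j).2)‖ ^ 2 *
          p) * S.indicator 1 (Real.sin (Real.pi * ((y : ℕ) : ℝ) / t) ^ 2) := by
  simp only [ampEst, Prog.prob, Prog.prob_pure]
  rw [Fintype.sum_prod_type, Fintype.sum_prod_type]
  refine Finset.sum_congr rfl fun y _ => ?_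
  rw [← sum_norm_sq_finalState_ampEst hψ hp, Finset.sum_mul]
  refine Finset.sum_congr rfl fun b _ => ?_
  rw [Finset.sum_mul]

end Circuit

/-! ### The distribution of the phase register -/

/-- The relative phase seen by outcome `y` of the phase register for eigenphase `2θ`. -/
noncomputable def phase (t : ℕ) (θ : ℝ) (y : ℕ) : ℂ :=
  Complex.exp (2 * (θ - Real.pi * y / t) * Complex.I)

theorem norm_phase (t : ℕ) (θ : ℝ) (y : ℕ) : ‖phase t θ y‖ = 1 := by
  have : (2 * (θ - Real.pi * y / t) * Complex.I : ℂ) =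
      ((2 * (θ - Real.pi * y / t) : ℝ) : ℂ) * Complex.I := by push_cast; ring
  rw [phase, this, Complex.norm_exp_ofReal_mul_I]

theorem norm_one_sub_phase (t : ℕ) (θ : ℝ) (y : ℕ) :
    ‖1 - phase t θ y‖ = 2 * |Real.sin (θ - Real.pi * y / t)| := by
  set x := θ - Real.pi * y / t with hx
  have h : phase t θ y = Complex.exp (Complex.I * ((2 * x : ℝ) : ℂ)) := by
    rw [phase, hx]; push_cast; ring_nf
  rw [h, norm_sub_rev, Complex.norm_exp_I_mul_ofReal_sub_one]
  rw [norm_mul, Real.norm_eq_abs, Real.norm_eq_abs, abs_two]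
  congr 3
  ring

theorem phase_pow (t : ℕ) (θ : ℝ) (y j : ℕ) :
    phase t θ y ^ j = Complex.exp (2 * θ * j * Complex.I) *
      Complex.exp (-(2 * Real.pi * Complex.I * y * j / t)) := by
  rw [phase, ← Complex.exp_nat_mul, ← Complex.exp_add]
  ring_nf

theorem star_qftMatrix (t : ℕ) (j y : Fin t) :
    star (qftMatrix t j y) =
      Complex.exp (-(2 * Real.pi * Complex.I * (y : ℕ) * (j : ℕ) / t)) / (√(t : ℝ) : ℝ) := by
  simp only [qftMatrix, Matrix.of_apply, star_div₀, Complex.star_def, Complex.conj_ofReal]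
  rw [← Complex.exp_conj]
  simp only [map_div₀, map_mul, Complex.conj_ofReal, Complex.conj_I, map_natCast, map_ofNat]
  ring_nf

/-- Parseval: up to the factor 1/√t, the inner sums are the inverse Fourier transform of the
sequence e^(2iθj) cut off at j < k, whose squared norm is k. -/
theorem sum_norm_sq_sum_phase_pow {t k : ℕ} (hk : k ≤ t) (θ : ℝ) :
    ∑ y : Fin t, ‖∑ j ∈ Finset.range k, phase t θ y ^ j‖ ^ 2 = t * k := by
  rcases Nat.eq_zero_or_pos t with rfl | ht
  · simp
  have h := sum_norm_sq_mulVec (G := (qftMatrix t)ᴴ) (Unitary.star_mem (qftMatrix_mem t))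
    fun j : Fin t => if (j : ℕ) < k then Complex.exp (2 * θ * (j : ℕ) * Complex.I) else 0
  have h1 : ∀ y : Fin t, ((qftMatrix t)ᴴ *ᵥ fun j : Fin t =>
      if (j : ℕ) < k then Complex.exp (2 * θ * (j : ℕ) * Complex.I) else 0) y =
      (∑ j ∈ Finset.range k, phase t θ y ^ j) / (√(t : ℝ) : ℝ) := by
    intro y
    simp only [Matrix.mulVec, dotProduct, Matrix.conjTranspose_apply, star_qftMatrix]
    rw [Fin.sum_univ_eq_sum_range (fun j => Complex.exp (-(2 * Real.pi * Complex.I * (y : ℕ) *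
      (j : ℕ) / t)) / (√(t : ℝ) : ℝ) * if j < k then Complex.exp (2 * θ * j * Complex.I) else 0) t]
    simp only [mul_ite, mul_zero]
    rw [← Finset.sum_filter, Finset.sum_div]
    have : (Finset.range t).filter (· < k) = Finset.range k := by ext; simp; omega
    rw [this]
    refine Finset.sum_congr rfl fun j _ => ?_
    rw [phase_pow]
    ring
  have h2 : ∑ j : Fin t, ‖if (j : ℕ) < k then Complex.exp (2 * θ * (j : ℕ) * Complex.I) else 0‖ ^ 2
      = (k : ℝ) := by
    rw [Fin.sum_univ_eq_sum_range (fun j =>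
      ‖if j < k then Complex.exp (2 * θ * j * Complex.I) else 0‖ ^ 2) t]
    have h3 : ∀ j : ℕ, ‖if j < k then Complex.exp (2 * θ * j * Complex.I) else 0‖ ^ 2 =
        if j < k then (1 : ℝ) else 0 := by
      intro j
      split_ifs
      · have : (2 * θ * j * Complex.I : ℂ) = ((2 * θ * j : ℝ) : ℂ) * Complex.I := by
          push_cast; ring
        rw [this, Complex.norm_exp_ofReal_mul_I, one_pow]
      · simp
    simp only [h3]
    rw [← Finset.sum_filter]
    have : (Finset.range t).filter (· < k) = Finset.range k := by ext; simp; omega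
    rw [this]
    simp
  rw [h2] at h
  simp only [h1, norm_div, div_pow, Complex.norm_real, Real.norm_eq_abs, sq_abs,
    Real.sq_sqrt (Nat.cast_nonneg t), ← Finset.sum_div] at h
  rw [div_eq_iff (by positivity)] at h
  linarith

/-- Here |1 - w|² = 2 - 2 Re w for |w| = 1, and the geometric sum of the powers of z has modulus at
most 2/|1 - z| ≤ M/2. So |1 - z^k|² is at least 1 on average. -/
theorem le_sum_norm_one_sub_pow {z : ℂ} (hz : ‖z‖ = 1) {M : ℕ} (h : 4 ≤ M * ‖1 - z‖) :
    (M : ℝ) ≤ ∑ k ∈ Finset.range M, ‖1 - z ^ (k + 1)‖ ^ 2 := by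
  have h1 : ∀ k, ‖1 - z ^ (k + 1)‖ ^ 2 = 2 - 2 * (z ^ (k + 1)).re := by
    intro k
    rw [Complex.sq_norm, Complex.normSq_sub]
    have : Complex.normSq (z ^ (k + 1)) = 1 := by
      rw [Complex.normSq_eq_norm_sq, norm_pow, hz]; simp
    rw [this]
    generalize z ^ (k + 1) = w
    simp
    ring
  have h2 : ‖∑ k ∈ Finset.range M, z ^ (k + 1)‖ * ‖1 - z‖ ≤ 2 := by
    have h3 : (∑ k ∈ Finset.range M, z ^ (k + 1)) * (1 - z) = z * (1 - z ^ M) := by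
      simp only [pow_succ', ← Finset.mul_sum]
      rw [mul_assoc, geom_sum_mul_neg]
    rw [← norm_mul, h3, norm_mul, hz, one_mul]
    refine (norm_sub_le _ _).trans ?_
    rw [norm_pow, hz]
    norm_num
  have h4 : ∑ k ∈ Finset.range M, (z ^ (k + 1)).re ≤ ‖∑ k ∈ Finset.range M, z ^ (k + 1)‖ := by
    rw [← Complex.re_sum]
    exact Complex.re_le_norm _
  simp only [h1, Finset.sum_sub_distrib, ← Finset.mul_sum]
  simp only [Finset.sum_const, Finset.card_range, nsmul_eq_mul]
  have h5 : 2 * ‖∑ k ∈ Finset.range M, z ^ (k + 1)‖ ≤ M := by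
    have hpos : 0 < ‖1 - z‖ := by
      by_contra hcon
      have : ‖1 - z‖ = 0 := le_antisymm (not_lt.1 hcon) (norm_nonneg _)
      rw [this] at h
      norm_num at h
    by_contra hcon
    nlinarith
  linarith

/-- The outcomes of the phase register that are far from the phase `θ`. -/
noncomputable def phaseTail (t : ℕ) (θ : ℝ) : Finset (Fin t) :=
  Finset.univ.filter fun y : Fin t => 80 / (t : ℝ) < |Real.sin (θ - Real.pi * (y : ℕ) / t)|

/-- The tail bound for phase estimation. -/
theorem sum_tail_phase_le {t : ℕ} (ht : 0 < t) (θ : ℝ) :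
    ∑ y ∈ phaseTail t θ,
      ‖∑ j ∈ Finset.range t, phase t θ y ^ j‖ ^ 2 ≤ t ^ 2 / 5 := by
  have ht' : (0 : ℝ) < t := by exact_mod_cast ht
  rcases lt_or_ge t 20 with hlt | hge
  -- For t < 20 the threshold 80/t exceeds 1 and the tail is empty; otherwise t/20 ≥ 1, so that t ≤
  -- 40 (t/20).
  · rw [phaseTail, Finset.filter_false_of_mem, Finset.sum_empty]
    · positivity
    · intro y _
      rw [not_lt]
      refine (Real.abs_sin_le_one _).trans ?_
      rw [le_div_iff₀ ht']
      have : (t : ℝ) < 20 := by exact_mod_cast hlt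
      linarith
  obtain ⟨M, hM⟩ : ∃ M, M = t / 20 := ⟨_, rfl⟩
  have hM1 : 1 ≤ M := by omega
  have hM2 : M * 20 ≤ t := by omega
  have hM3 : t ≤ 40 * M := by omega
  have hM1' : (1 : ℝ) ≤ M := by exact_mod_cast hM1
  have hM2' : (M : ℝ) * 20 ≤ t := by exact_mod_cast hM2
  have hM3' : (t : ℝ) ≤ 40 * M := by exact_mod_cast hM3
  -- |1 - z^t|² ≤ 4 is compared with the average of |1 - z^k|² over 1 ≤ k ≤ M, which is at least 1.
  -- Cancelling |1 - z|² turns both into geometric sums.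
  have key : ∀ y : Fin t, 80 / (t : ℝ) < |Real.sin (θ - Real.pi * (y : ℕ) / t)| →
      M * ‖∑ j ∈ Finset.range t, phase t θ y ^ j‖ ^ 2 ≤
        ∑ k ∈ Finset.range M, 4 * ‖∑ j ∈ Finset.range (k + 1), phase t θ y ^ j‖ ^ 2 := by
    intro y hy
    set z := phase t θ y with hz
    have hn : ‖z‖ = 1 := norm_phase _ _ _
    have hd : ‖1 - z‖ = 2 * |Real.sin (θ - Real.pi * (y : ℕ) / t)| := norm_one_sub_phase _ _ _
    have hd0 : 0 < ‖1 - z‖ := by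
      rw [hd]
      have : 0 < 80 / (t : ℝ) := by positivity
      linarith
    have hbig : 4 ≤ M * ‖1 - z‖ := by
      rw [div_lt_iff₀ ht'] at hy
      rw [hd]
      have := abs_nonneg (Real.sin (θ - Real.pi * (y : ℕ) / t))
      nlinarith
    have hlow := le_sum_norm_one_sub_pow hn hbig
    have hgeom : ∀ k, ‖1 - z ^ k‖ = ‖∑ j ∈ Finset.range k, z ^ j‖ * ‖1 - z‖ := by
      intro k
      rw [← norm_mul, geom_sum_mul_neg]
    have h4 : (‖∑ j ∈ Finset.range t, z ^ j‖ * ‖1 - z‖) ^ 2 ≤ 4 := by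
      rw [← hgeom]
      have : ‖1 - z ^ t‖ ≤ 2 := by
        refine (norm_sub_le _ _).trans ?_
        rw [norm_pow, hn]
        norm_num
      nlinarith [norm_nonneg (1 - z ^ t)]
    simp only [hgeom, mul_pow, ← Finset.sum_mul] at hlow
    rw [mul_pow] at h4
    rw [← Finset.mul_sum]
    set A := ∑ k ∈ Finset.range M, ‖∑ j ∈ Finset.range (k + 1), z ^ j‖ ^ 2
    have hA : 0 ≤ A := Finset.sum_nonneg fun _ _ => by positivity
    set X := ‖∑ j ∈ Finset.range t, z ^ j‖ ^ 2
    have hX : 0 ≤ X := by positivity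
    calc M * X ≤ A * ‖1 - z‖ ^ 2 * X := mul_le_mul_of_nonneg_right hlow hX
      _ = A * (X * ‖1 - z‖ ^ 2) := by ring
      _ ≤ A * 4 := mul_le_mul_of_nonneg_left h4 hA
      _ = 4 * A := by ring
  have hsum : M * ∑ y ∈ phaseTail t θ,
      ‖∑ j ∈ Finset.range t, phase t θ y ^ j‖ ^ 2 ≤
        ∑ k ∈ Finset.range M, 4 * ((t : ℝ) * (k + 1)) := by
    rw [Finset.mul_sum]
    calc _ ≤ ∑ y ∈ phaseTail t θ,
          ∑ k ∈ Finset.range M, 4 * ‖∑ j ∈ Finset.range (k + 1), phase t θ y ^ j‖ ^ 2 :=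
          Finset.sum_le_sum fun y hy => key y (Finset.mem_filter.1 hy).2
      _ ≤ ∑ y : Fin t,
          ∑ k ∈ Finset.range M, 4 * ‖∑ j ∈ Finset.range (k + 1), phase t θ y ^ j‖ ^ 2 :=
          Finset.sum_le_sum_of_subset_of_nonneg (Finset.subset_univ _) fun _ _ _ =>
            Finset.sum_nonneg fun _ _ => by positivity
      _ = _ := by
          rw [Finset.sum_comm]
          refine Finset.sum_congr rfl fun k hk => ?_
          have := Finset.mem_range.1 hk
          rw [← Finset.mul_sum, sum_norm_sq_sum_phase_pow (by omega)]
          push_cast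
          ring
  have hbound : ∑ k ∈ Finset.range M, 4 * ((t : ℝ) * (k + 1)) ≤ M * (t ^ 2 / 5) := by
    calc _ ≤ ∑ k ∈ Finset.range M, (t : ℝ) ^ 2 / 5 := by
          refine Finset.sum_le_sum fun k hk => ?_
          have : (k : ℝ) + 1 ≤ M := by exact_mod_cast Finset.mem_range.1 hk
          nlinarith
      _ = _ := by simp
  exact le_of_mul_le_mul_left (hsum.trans hbound) (by linarith)

/-- Kept as products with cos θ and sin θ, the identities also cover p = 0 and p = 1. -/
theorem groverCoeff_eq (θ : ℝ) (m : ℕ) :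
    Real.cos θ * (groverCoeff (Real.sin θ ^ 2) m).1 = Real.cos ((2 * m + 1) * θ) ∧
      Real.sin θ * (groverCoeff (Real.sin θ ^ 2) m).2 = Real.sin ((2 * m + 1) * θ) := by
  induction m with
  | zero => simp [groverCoeff]
  | succ m ih =>
    have h : (2 * ((m + 1 : ℕ) : ℝ) + 1) * θ = (2 * m + 1) * θ + 2 * θ := by push_cast; ring
    rw [h, Real.cos_add, Real.sin_add, Real.cos_two_mul, Real.sin_two_mul, ← ih.1, ← ih.2,
      groverCoeff]
    have hs : Real.sin θ ^ 2 = 1 - Real.cos θ ^ 2 := by rw [← Real.cos_sq_add_sin_sq θ]; ring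
    constructor
    · linear_combination -2 * Real.cos θ * (groverCoeff (Real.sin θ ^ 2) m).1 * hs
    · linear_combination (-2 * Real.sin θ * (groverCoeff (Real.sin θ ^ 2) m).2
        - 2 * Real.sin θ * (groverCoeff (Real.sin θ ^ 2) m).1) * hs

/-- Writing cosine and sine as combinations of e^(±i(2j+1)θ) gives the components (a + b)/(2t) and
-i(a - b)/(2t). The parallelogram law then removes the interference between the two eigenphases. -/
theorem norm_sq_groverCoeff (t : ℕ) (θ : ℝ) (y : Fin t) :
    ‖∑ j : Fin t, star (qftMatrix t j y) *
        (1 / (√(t : ℝ) : ℝ) * (groverCoeff (Real.sin θ ^ 2) j).1)‖ ^ 2 * (1 - Real.sin θ ^ 2) +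
      ‖∑ j : Fin t, star (qftMatrix t j y) *
        (1 / (√(t : ℝ) : ℝ) * (groverCoeff (Real.sin θ ^ 2) j).2)‖ ^ 2 * Real.sin θ ^ 2 =
      (‖∑ j ∈ Finset.range t, phase t θ y ^ j‖ ^ 2 +
        ‖∑ j ∈ Finset.range t, phase t (-θ) y ^ j‖ ^ 2) / (2 * t ^ 2) := by
  have ht : 0 < t := y.pos
  have hts : ((√(t : ℝ) : ℝ) : ℂ) * ((√(t : ℝ) : ℝ) : ℂ) = t := by
    rw [← Complex.ofReal_mul, Real.mul_self_sqrt (Nat.cast_nonneg t)]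
    simp
  have htc : (t : ℂ) ≠ 0 := by exact_mod_cast ht.ne'
  set a := Complex.exp (θ * Complex.I) * ∑ j ∈ Finset.range t, phase t θ y ^ j with ha
  set b := Complex.exp (-θ * Complex.I) * ∑ j ∈ Finset.range t, phase t (-θ) y ^ j with hb
  have hna : ‖∑ j ∈ Finset.range t, phase t θ y ^ j‖ = ‖a‖ := by
    rw [ha, norm_mul, Complex.norm_exp_ofReal_mul_I, one_mul]
  have hnb : ‖∑ j ∈ Finset.range t, phase t (-θ) y ^ j‖ = ‖b‖ := by
    rw [hb, norm_mul, ← Complex.ofReal_neg, Complex.norm_exp_ofReal_mul_I, one_mul]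
  have hexp : ∀ j : ℕ, Complex.exp (((2 * j + 1) * θ : ℂ) * Complex.I) =
      Complex.exp (θ * Complex.I) * Complex.exp (2 * θ * j * Complex.I) := by
    intro j
    rw [← Complex.exp_add]
    ring_nf
  have hexp' : ∀ j : ℕ, Complex.exp (-((2 * j + 1) * θ : ℂ) * Complex.I) =
      Complex.exp (-θ * Complex.I) * Complex.exp (2 * (-θ : ℝ) * j * Complex.I) := by
    intro j
    rw [← Complex.exp_add]
    push_cast
    ring_nf
  have hc : (∑ j : Fin t, star (qftMatrix t j y) *
        (1 / (√(t : ℝ) : ℝ) * (groverCoeff (Real.sin θ ^ 2) j).1)) * Real.cos θ =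
      (a + b) / (2 * t) := by
    have h1 : ∀ j : ℕ, (Real.cos θ : ℂ) * ((groverCoeff (Real.sin θ ^ 2) j).1 : ℂ) =
        Complex.cos ((2 * j + 1) * θ) := by
      intro j
      rw [← Complex.ofReal_mul, (groverCoeff_eq θ j).1]
      push_cast
      rfl
    rw [Finset.sum_mul, ha, hb, Finset.mul_sum, Finset.mul_sum, ← Finset.sum_add_distrib,
      Finset.sum_div, ← Fin.sum_univ_eq_sum_range (fun j => (Complex.exp (θ * Complex.I) *
        phase t θ y ^ j + Complex.exp (-θ * Complex.I) * phase t (-θ) y ^ j) / (2 * (t : ℂ)))]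
    refine Finset.sum_congr rfl fun j _ => ?_
    have h2 := h1 j
    rw [Complex.cos, hexp, hexp'] at h2
    rw [star_qftMatrix, phase_pow, phase_pow]
    set E := Complex.exp (-(2 * Real.pi * Complex.I * (y : ℕ) * (j : ℕ) / t))
    calc _ = E / ((√(t : ℝ) : ℝ) * (√(t : ℝ) : ℝ) : ℂ) *
          (Real.cos θ * ((groverCoeff (Real.sin θ ^ 2) j).1 : ℂ)) := by
          rw [div_mul_eq_mul_div, div_mul_eq_mul_div, div_mul_eq_mul_div, ← div_div]; ring
      _ = _ := by
          rw [hts, h2]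
          field_simp
  have hs : (∑ j : Fin t, star (qftMatrix t j y) *
        (1 / (√(t : ℝ) : ℝ) * (groverCoeff (Real.sin θ ^ 2) j).2)) * Real.sin θ =
      (a - b) / (2 * t) * (-Complex.I) := by
    have h1 : ∀ j : ℕ, (Real.sin θ : ℂ) * ((groverCoeff (Real.sin θ ^ 2) j).2 : ℂ) =
        Complex.sin ((2 * j + 1) * θ) := by
      intro j
      rw [← Complex.ofReal_mul, (groverCoeff_eq θ j).2]
      push_cast
      rfl
    rw [Finset.sum_mul, ha, hb, Finset.mul_sum, Finset.mul_sum, ← Finset.sum_sub_distrib,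
      Finset.sum_div, Finset.sum_mul,
      ← Fin.sum_univ_eq_sum_range (fun j => (Complex.exp (θ * Complex.I) *
        phase t θ y ^ j - Complex.exp (-θ * Complex.I) * phase t (-θ) y ^ j) / (2 * (t : ℂ)) *
          (-Complex.I))]
    refine Finset.sum_congr rfl fun j _ => ?_
    have h2 := h1 j
    rw [Complex.sin, hexp, hexp'] at h2
    rw [star_qftMatrix, phase_pow, phase_pow]
    set E := Complex.exp (-(2 * Real.pi * Complex.I * (y : ℕ) * (j : ℕ) / t))
    calc _ = E / ((√(t : ℝ) : ℝ) * (√(t : ℝ) : ℝ) : ℂ) *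
          (Real.sin θ * ((groverCoeff (Real.sin θ ^ 2) j).2 : ℂ)) := by
          rw [div_mul_eq_mul_div, div_mul_eq_mul_div, div_mul_eq_mul_div, ← div_div]; ring
      _ = _ := by
          rw [hts, h2]
          field_simp
          ring
  have hnc := congrArg (fun w : ℂ => ‖w‖ ^ 2) hc
  have hns := congrArg (fun w : ℂ => ‖w‖ ^ 2) hs
  simp only [norm_mul, norm_div, norm_neg, Complex.norm_I, mul_one, mul_pow, div_pow,
    Complex.norm_real, Real.norm_eq_abs, sq_abs, Complex.norm_natCast, Complex.norm_two] at hnc hns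
  have hpar := parallelogram_law_with_norm ℝ a b
  rw [hna, hnb, ← Real.cos_sq', hnc, hns, ← add_div]
  have ht0 : (t : ℝ) ≠ 0 := by exact_mod_cast ht.ne'
  field_simp
  linarith

/-- The accuracy of amplitude estimation. -/
theorem prob_ampEst_le {n k : ℕ} {q : Fin k ↪ Fin n} {f : Bits k → unitInterval} {ψ : Bits n → ℂ}
    (t : ℕ+) (hψ : ∑ z, ‖ψ z‖ ^ 2 = 1) {p e : ℝ} (hp : p = avg q ψ fun x => f x)
    (he : 160 * √p / t + 6400 / t ^ 2 ≤ e) :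
    (ampEst t q f).prob ψ (Set.Icc (p - e) (p + e))ᶜ ≤ 1 / 5 := by
  have hp0 : 0 ≤ p := by
    rw [hp]
    exact Finset.sum_nonneg fun z _ => mul_nonneg (by positivity) (f _).2.1
  have hp1 : p ≤ 1 := by
    rw [hp, ← hψ]
    exact Finset.sum_le_sum fun z _ => mul_le_of_le_one_right (by positivity) (f _).2.2
  have ht : (0 : ℝ) < (t : ℕ) := by exact_mod_cast t.pos
  set θ := Real.arcsin √p with hθ
  have hsin : Real.sin θ = √p :=
    Real.sin_arcsin (by linarith [Real.sqrt_nonneg p]) (Real.sqrt_le_one.2 hp1)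
  have hsin2 : p = Real.sin θ ^ 2 := by rw [hsin, Real.sq_sqrt hp0]
  rw [prob_ampEst t hψ hp]
  -- A bad output lies in the tails of both θ and -θ, so the two halves of the mixture can be
  -- bounded separately.
  have hout : ∀ y : ℕ, Real.sin (Real.pi * (y : ℝ) / (t : ℕ)) ^ 2 ∈ (Set.Icc (p - e) (p + e))ᶜ →
      ∀ τ : ℝ, (τ = θ ∨ τ = -θ) → 80 / ((t : ℕ) : ℝ) < |Real.sin (τ - Real.pi * y / (t : ℕ))| := by
    intro y hy τ hτ
    by_contra hcon
    rw [not_lt] at hcon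
    apply hy
    have hτ2 : p = Real.sin τ ^ 2 := by
      rcases hτ with rfl | rfl
      · exact hsin2
      · rw [Real.sin_neg, neg_sq]; exact hsin2
    have hτ1 : |Real.sin τ| = √p := by rw [hτ2, Real.sqrt_sq_eq_abs]
    set u := Real.pi * (y : ℝ) / (t : ℕ)
    -- One factor is at most 80/t. The other, by τ + u = 2τ - (τ - u), is at most 2√p + 80/t; this
    -- is the source of the √p in the error.
    have hprod : Real.sin u ^ 2 - p = -(Real.sin (τ - u) * Real.sin (τ + u)) := by
      rw [hτ2, Real.sin_sub, Real.sin_add]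
      have h1 := Real.sin_sq_add_cos_sq τ
      have h2 := Real.sin_sq_add_cos_sq u
      linear_combination -(Real.sin u ^ 2) * h1 + Real.sin τ ^ 2 * h2
    have hplus : |Real.sin (τ + u)| ≤ 2 * √p + 80 / ((t : ℕ) : ℝ) := by
      have h1 : τ + u = 2 * τ - (τ - u) := by ring
      rw [h1, Real.sin_sub, Real.sin_two_mul]
      have h3 : |2 * Real.sin τ * Real.cos τ * Real.cos (τ - u)| ≤ 2 * √p := by
        rw [abs_mul, abs_mul, abs_mul, hτ1, abs_two]
        have hc1 := Real.abs_cos_le_one τ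
        have hc2 := Real.abs_cos_le_one (τ - u)
        have : |Real.cos τ| * |Real.cos (τ - u)| ≤ 1 :=
          mul_le_one₀ hc1 (abs_nonneg _) hc2
        nlinarith [Real.sqrt_nonneg p]
      have h4 : |Real.cos (2 * τ) * Real.sin (τ - u)| ≤ 80 / ((t : ℕ) : ℝ) := by
        rw [abs_mul]
        refine (mul_le_of_le_one_left (abs_nonneg _) (Real.abs_cos_le_one _)).trans hcon
      exact (abs_sub _ _).trans (add_le_add h3 h4)
    have habs : |Real.sin u ^ 2 - p| ≤ e := by
      rw [hprod, abs_neg, abs_mul]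
      refine (mul_le_mul hcon hplus (abs_nonneg _) (by positivity)).trans (le_trans (le_of_eq ?_) he)
      field_simp
      ring
    rw [abs_le] at habs
    constructor <;> linarith
  have hterm : ∀ y : Fin t, (‖∑ j : Fin t, star (qftMatrix t j y) *
        (1 / (√(t : ℝ) : ℝ) * (groverCoeff p j).1)‖ ^ 2 * (1 - p) +
      ‖∑ j : Fin t, star (qftMatrix t j y) *
        (1 / (√(t : ℝ) : ℝ) * (groverCoeff p j).2)‖ ^ 2 * p) *
      (Set.Icc (p - e) (p + e))ᶜ.indicator 1 (Real.sin (Real.pi * ((y : ℕ) : ℝ) / t) ^ 2) ≤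
      ((if 80 / ((t : ℕ) : ℝ) < |Real.sin (θ - Real.pi * (y : ℕ) / (t : ℕ))| then
        ‖∑ j ∈ Finset.range t, phase t θ y ^ j‖ ^ 2 else 0) +
      (if 80 / ((t : ℕ) : ℝ) < |Real.sin (-θ - Real.pi * (y : ℕ) / (t : ℕ))| then
        ‖∑ j ∈ Finset.range t, phase t (-θ) y ^ j‖ ^ 2 else 0)) / (2 * (t : ℝ) ^ 2) := by
    intro y
    by_cases hy : Real.sin (Real.pi * ((y : ℕ) : ℝ) / (t : ℕ)) ^ 2 ∈ (Set.Icc (p - e) (p + e))ᶜ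
    · rw [Set.indicator_of_mem hy, if_pos (hout y hy θ (Or.inl rfl)),
        if_pos (hout y hy (-θ) (Or.inr rfl)), Pi.one_apply, mul_one]
      have := norm_sq_groverCoeff t θ y
      rw [← hsin2] at this
      exact this.le
    · rw [Set.indicator_of_notMem hy, mul_zero]
      positivity
  refine (Finset.sum_le_sum fun y _ => hterm y).trans ?_
  rw [← Finset.sum_div, Finset.sum_add_distrib, ← Finset.sum_filter, ← Finset.sum_filter,
    div_le_iff₀ (by positivity)]
  have h1 := sum_tail_phase_le t.pos θ
  have h2 := sum_tail_phase_le t.pos (-θ)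
  rw [phaseTail] at h1 h2
  linarith

theorem Prog.prob_map_le {n : ℕ} {α β : Type} {ψ : Bits n → ℂ} (hψ : ∑ z, ‖ψ z‖ ^ 2 = 1)
    {p : Prog n α} {g : α → β} {T : Set α} {S : Set β} {a : ℝ} (hp : p.prob ψ Tᶜ ≤ a)
    (hg : ∀ x ∈ T, g x ∈ S) : (p >>= fun x => pure (g x)).prob ψ Sᶜ ≤ a := by
  rw [← add_zero a]
  refine Prog.prob_bind_le hψ hp (fun x hx => ?_) le_rfl
  rw [Prog.prob_pure, Set.indicator_of_notMem (by simpa using hg x hx)]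

section Estimators

variable {n k : ℕ} {q : Fin k ↪ Fin n} {ψ : Bits n → ℂ}

/-! ### Averages -/

theorem avg_add (f g : Bits k → ℝ) : (avg q ψ fun x => f x + g x) = avg q ψ f + avg q ψ g := by
  simp only [avg, mul_add, Finset.sum_add_distrib]

theorem avg_const_mul (c : ℝ) (f : Bits k → ℝ) : (avg q ψ fun x => c * f x) = c * avg q ψ f := by
  simp only [avg, Finset.mul_sum, mul_left_comm]

theorem avg_const (hψ : ∑ z, ‖ψ z‖ ^ 2 = 1) (c : ℝ) : (avg q ψ fun _ => c) = c := by
  rw [avg, ← Finset.sum_mul, hψ, one_mul]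

theorem avg_sum (s : Finset ℕ) (f : ℕ → Bits k → ℝ) :
    (avg q ψ fun x => ∑ i ∈ s, f i x) = ∑ i ∈ s, avg q ψ (f i) := by
  simp only [avg, Finset.mul_sum]
  exact Finset.sum_comm

theorem avg_mono {f g : Bits k → ℝ} (h : ∀ x, f x ≤ g x) : avg q ψ f ≤ avg q ψ g :=
  Finset.sum_le_sum fun z _ => mul_le_mul_of_nonneg_left (h _) (by positivity)

theorem avg_nonneg {f : Bits k → ℝ} (h : ∀ x, 0 ≤ f x) : 0 ≤ avg q ψ f :=
  Finset.sum_nonneg fun z _ => mul_nonneg (by positivity) (h _)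

/-! ### Mean estimation for bounded outputs -/

theorem prob_meanBounded_le (hψ : ∑ z, ‖ψ z‖ ^ 2 = 1) {f : Bits k → unitInterval} {t : ℕ+}
    {c δ e : ℝ} (hc : 10 ≤ c) (hδ : 0 < δ) (hδ1 : δ ≤ 1)
    (he : 160 * √(avg q ψ fun x => f x) / t + 6400 / t ^ 2 ≤ e) :
    (meanBounded c q f t δ).prob ψ
      (Set.Icc ((avg q ψ fun x => f x) - e) ((avg q ψ fun x => f x) + e))ᶜ ≤ δ :=
  prob_powered_le hψ (prob_ampEst_le t hψ rfl he) hδ hc hδ1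

/-! ### Dyadic slices -/

/-- The slice of `f` with values in `[2 ^ l, 2 ^ (l + 1))`, divided by `2 ^ (l + 1)`. -/
noncomputable def dyadicSlice (f : Bits k → ℝ) (l : ℕ) : Bits k → unitInterval :=
  slice f (2 ^ l) (2 ^ (l + 1)) (by positivity)

theorem mul_dyadicSlice (f : Bits k → ℝ) (l : ℕ) (x : Bits k) :
    2 ^ (l + 1) * (dyadicSlice f l x : ℝ) =
      if 2 ^ l ≤ f x ∧ f x < 2 ^ (l + 1) then f x else 0 := by
  rw [dyadicSlice, slice]
  exact mul_div_cancel₀ _ (by positivity)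

theorem sum_dyadicSlice {f : Bits k → ℝ} (hf : ∀ x, 0 ≤ f x) (m : ℕ) (x : Bits k) :
    (slice f 0 1 le_rfl x : ℝ) + ∑ l ∈ Finset.range m, 2 ^ (l + 1) * (dyadicSlice f l x : ℝ) =
      if f x < 2 ^ m then f x else 0 := by
  induction m with
  | zero => simp [slice, hf x]
  | succ m ih =>
    rw [Finset.sum_range_succ, ← add_assoc, ih, mul_dyadicSlice]
    have h2 : (2 : ℝ) ^ m ≤ 2 ^ (m + 1) := pow_le_pow_right₀ (by norm_num) (by omega)
    by_cases h : f x < 2 ^ m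
    · rw [if_pos h, if_neg (fun hc => absurd h (not_lt.2 hc.1)), if_pos (h.trans_le h2), add_zero]
    · rw [if_neg h, zero_add]
      simp [not_lt.1 h]

/-- On its slice the summand is 2^(l+1) f, and 2^(l+1) ≤ 2f there; at most one slice contributes. -/
theorem sum_sq_mul_dyadicSlice_le (f : Bits k → ℝ) (m : ℕ) (x : Bits k) :
    ∑ l ∈ Finset.range m, (2 ^ (l + 1)) ^ 2 * (dyadicSlice f l x : ℝ) ≤
      if f x < 2 ^ m then 2 * f x ^ 2 else 0 := by
  induction m with
  | zero =>
    rw [Finset.sum_range_zero]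
    split_ifs <;> positivity
  | succ m ih =>
    rw [Finset.sum_range_succ, sq, mul_assoc, mul_dyadicSlice]
    refine (add_le_add_left ih _).trans ?_
    have h2 : (2 : ℝ) ^ (m + 1) = 2 * 2 ^ m := pow_succ' _ _
    have h3 : (0 : ℝ) < 2 ^ m := by positivity
    by_cases h : f x < 2 ^ m
    · rw [if_pos h, if_neg (fun hc => absurd h (not_lt.2 hc.1)), if_pos (by linarith)]
      simp
    · rw [if_neg h, zero_add]
      by_cases h' : f x < 2 ^ (m + 1)
      · rw [if_pos ⟨not_lt.1 h, h'⟩, if_pos h', h2]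
        nlinarith [not_lt.1 h]
      · rw [if_neg (fun hc => h' hc.2), if_neg h', mul_zero]

theorem prob_sliceSum_le (hψ : ∑ z, ‖ψ z‖ ^ 2 = 1) (f : Bits k → ℝ) (t : ℕ+)
    {c δ : ℝ} (hc : 10 ≤ c) (hδ : 0 < δ) (hδ1 : δ ≤ 1) (m : ℕ) :
    (sliceSum c q f t δ m).prob ψ {s |
      |s - ∑ l ∈ Finset.range m, 2 ^ (l + 1) * avg q ψ fun x => dyadicSlice f l x| ≤
        ∑ l ∈ Finset.range m, 2 ^ (l + 1) *
          (160 * √(avg q ψ fun x => dyadicSlice f l x) / t + 6400 / t ^ 2)}ᶜ ≤ m * δ := by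
  induction m with
  | zero => simp [sliceSum]
  | succ m ih =>
    rw [sliceSum]
    push_cast
    rw [add_mul, one_mul]
    refine Prog.prob_bind_le hψ ih (fun s hs => ?_) hδ.le
    refine Prog.prob_map_le hψ
      (prob_meanBounded_le (f := dyadicSlice f m) hψ hc hδ hδ1 le_rfl) fun μ hμ => ?_
    simp only [Set.mem_ofPred_eq, Finset.sum_range_succ, Set.mem_Icc, abs_le] at hs hμ ⊢
    have h2 : (0 : ℝ) < 2 ^ (m + 1) := by positivity
    have h3 := mul_le_mul_of_nonneg_left hμ.1 h2.le
    have h4 := mul_le_mul_of_nonneg_left hμ.2 h2.le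
    rw [mul_sub] at h3
    rw [mul_add] at h4
    constructor <;> linarith [hs.1, hs.2]

/-! ### Mean estimation for outputs with bounded second moment -/

/-- `Nat.toPNat'` sends 0 to 1, so positivity of the argument is what makes the ceiling bounds
apply. -/
theorem le_iterations {D ε : ℝ} (h : 0 < D * √(Real.logb 2 (1 / ε)) / ε) :
    D * √(Real.logb 2 (1 / ε)) / ε ≤ ((iterations D ε : ℕ) : ℝ) ∧
      ((iterations D ε : ℕ) : ℝ) ≤ D * √(Real.logb 2 (1 / ε)) / ε + 1 := by
  rw [iterations, Nat.toPNat'_coe, if_pos (Nat.ceil_pos.2 h)]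
  exact ⟨Nat.le_ceil _, (Nat.ceil_lt_add_one h.le).le⟩

theorem three_le_logb {ε : ℝ} (hε : 0 < ε) (hε1 : ε ≤ 1 / 8) : 3 ≤ Real.logb 2 (1 / ε) := by
  rw [Real.le_logb_iff_rpow_le (by norm_num) (by positivity), le_div_iff₀ hε]
  norm_num
  linarith

/-- The terms linear in 1/t are controlled by Cauchy–Schwarz over the slices, the quadratic ones by
the geometric sum ∑ 2^(l+1) ≤ 4/ε. The separate 160/t belongs to the slice [0,1), where √p ≤ 1. -/
theorem sum_slice_error_le {f : Bits k → ℝ}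
    (hf2 : (avg q ψ fun x => f x ^ 2) ≤ 1) {ε t : ℝ} (hε : 0 < ε) (hε1 : ε ≤ 1 / 8)
    (ht : 1000 * √(Real.logb 2 (1 / ε)) / ε ≤ t) :
    160 / t + 6400 / t ^ 2 + ∑ l ∈ Finset.range ⌈Real.logb 2 (1 / ε)⌉₊, 2 ^ (l + 1) *
          (160 * √(avg q ψ fun x => dyadicSlice f l x) / t + 6400 / t ^ 2) ≤ 3 * ε := by
  set L := Real.logb 2 (1 / ε) with hL
  have hL3 : 3 ≤ L := three_le_logb hε hε1
  set K := ⌈L⌉₊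
  have hK1 : (K : ℝ) ≤ L + 1 := (Nat.ceil_lt_add_one (by linarith)).le
  obtain ⟨w, hw⟩ : ∃ w, w = √L := ⟨_, rfl⟩
  have hw2 : w ^ 2 = L := by rw [hw, Real.sq_sqrt (by linarith)]
  have hw1 : 1 ≤ w := by rw [hw, Real.one_le_sqrt]; linarith
  have hwpos : 0 < w := by linarith
  rw [← hw] at ht
  have htpos : 0 < t := lt_of_lt_of_le (by positivity) ht
  have hpow : (2 : ℝ) ^ K ≤ 2 / ε := by
    calc (2 : ℝ) ^ K = (2 : ℝ) ^ (K : ℝ) := (Real.rpow_natCast _ _).symm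
      _ ≤ 2 ^ (L + 1) := Real.rpow_le_rpow_of_exponent_le (by norm_num) hK1
      _ = 2 / ε := by
        rw [Real.rpow_add (by norm_num), hL, Real.rpow_logb (by norm_num) (by norm_num)
          (by positivity)]
        simp
        ring
  have hgeom : ∑ l ∈ Finset.range K, (2 : ℝ) ^ (l + 1) ≤ 4 / ε := by
    have : ∑ l ∈ Finset.range K, (2 : ℝ) ^ (l + 1) = 2 * (2 ^ K - 1) := by
      simp only [pow_succ', ← Finset.mul_sum]
      rw [geom_sum_eq (by norm_num)]
      norm_num
    rw [this]
    have h4 : 4 / ε = 2 * (2 / ε) := by ring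
    rw [h4]
    linarith
  have hsq : ∑ l ∈ Finset.range K, (2 ^ (l + 1)) ^ 2 * (avg q ψ fun x => dyadicSlice f l x) ≤ 2 := by
    simp only [← avg_const_mul]
    rw [← avg_sum]
    calc _ ≤ avg q ψ fun x => 2 * f x ^ 2 := by
          refine avg_mono fun x => (sum_sq_mul_dyadicSlice_le f K x).trans ?_
          split_ifs
          · exact le_rfl
          · positivity
      _ ≤ 2 := by rw [avg_const_mul]; linarith
  -- Cauchy–Schwarz through the termwise inequality a ≤ a²w/2 + 1/(2w), with w = √L and K ≤ L + 1 ≤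
  -- 2w².
  have hroot : ∑ l ∈ Finset.range K, 2 ^ (l + 1) * √(avg q ψ fun x => dyadicSlice f l x) ≤
      2 * w := by
    calc _ ≤ ∑ l ∈ Finset.range K, ((2 ^ (l + 1)) ^ 2 * (avg q ψ fun x => dyadicSlice f l x) *
          (w / 2) + 1 / (2 * w)) := by
          refine Finset.sum_le_sum fun l _ => ?_
          have h0 : 0 ≤ avg q ψ fun x => (dyadicSlice f l x : ℝ) :=
            avg_nonneg fun x => (dyadicSlice f l x).2.1
          nth_rewrite 2 [← Real.sq_sqrt h0]
          rw [← mul_pow]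
          set a := 2 ^ (l + 1) * √(avg q ψ fun x => dyadicSlice f l x)
          have : a ^ 2 * (w / 2) + 1 / (2 * w) - a = (a * w - 1) ^ 2 / (2 * w) := by
            field_simp
            ring
          have h' : 0 ≤ (a * w - 1) ^ 2 / (2 * w) := by positivity
          linarith
      _ ≤ 2 * (w / 2) + K * (1 / (2 * w)) := by
          rw [Finset.sum_add_distrib, ← Finset.sum_mul]
          simp only [Finset.sum_const, Finset.card_range, nsmul_eq_mul]
          gcongr
      _ ≤ 2 * (w / 2) + 2 * w ^ 2 * (1 / (2 * w)) := by
          gcongr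
          rw [hw2]; linarith
      _ = 2 * w := by field_simp; ring
  have hsplit : ∑ l ∈ Finset.range K, 2 ^ (l + 1) *
      (160 * √(avg q ψ fun x => dyadicSlice f l x) / t + 6400 / t ^ 2) =
      160 / t * ∑ l ∈ Finset.range K, 2 ^ (l + 1) * √(avg q ψ fun x => dyadicSlice f l x) +
      6400 / t ^ 2 * ∑ l ∈ Finset.range K, 2 ^ (l + 1) := by
    rw [Finset.mul_sum, Finset.mul_sum, ← Finset.sum_add_distrib]
    exact Finset.sum_congr rfl fun l _ => by ring
  rw [hsplit]
  have hu : 1 / t ≤ ε / (1000 * w) := by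
    rw [div_le_iff₀ hε] at ht
    rw [div_le_div_iff₀ htpos (by positivity)]
    linarith
  have huw : 1 / t * w ≤ ε / 1000 := by
    calc 1 / t * w ≤ ε / (1000 * w) * w := by gcongr
      _ = ε / 1000 := by field_simp
  have hu1 : 1 / t ≤ ε / 1000 := by
    refine le_trans ?_ huw
    exact le_mul_of_one_le_right (by positivity) hw1
  have hu2 : (1 / t) ^ 2 ≤ (ε / 1000) ^ 2 := by gcongr
  have h1 := mul_le_mul_of_nonneg_left hroot (show 0 ≤ 160 / t by positivity)
  have h2 := mul_le_mul_of_nonneg_left hgeom (show 0 ≤ 6400 / t ^ 2 by positivity)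
  have h3 : 6400 / t ^ 2 * (4 / ε) ≤ ε := by
    calc 6400 / t ^ 2 * (4 / ε) = 25600 / ε * (1 / t) ^ 2 := by ring
      _ ≤ 25600 / ε * (ε / 1000) ^ 2 := by gcongr
      _ = 256 / 10000 * ε := by field_simp; norm_num
      _ ≤ ε := by linarith
  have h4 : 160 / t = 160 * (1 / t) := by ring
  have h5 : 160 / t * (2 * w) = 320 * (1 / t * w) := by ring
  have h6 : 6400 / t ^ 2 = 6400 * (1 / t) ^ 2 := by ring
  have h7 : 6400 * (1 / t) ^ 2 ≤ ε := by nlinarith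
  linarith

theorem prob_meanL2_le (hψ : ∑ z, ‖ψ z‖ ^ 2 = 1) {f : Bits k → ℝ} (hf : ∀ x, 0 ≤ f x)
    (hf2 : (avg q ψ fun x => f x ^ 2) ≤ 1) {c ε : ℝ} (hc : 10 ≤ c) (hε : 0 < ε)
    (hε1 : ε ≤ 1 / 8) :
    (meanL2 1000 c q f ε).prob ψ (Set.Icc (avg q ψ f - 4 * ε) (avg q ψ f + 4 * ε))ᶜ ≤ 1 / 5 := by
  have hL3 : 3 ≤ Real.logb 2 (1 / ε) := three_le_logb hε hε1
  have ht := (le_iterations (D := 1000) (ε := ε) (by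
    have : 0 < √(Real.logb 2 (1 / ε)) := Real.sqrt_pos.2 (by linarith)
    positivity)).1
  have herr := sum_slice_error_le (q := q) (ψ := ψ) hf2 hε hε1 ht
  set t := iterations 1000 ε
  have hLK : Real.logb 2 (1 / ε) ≤ (⌈Real.logb 2 (1 / ε)⌉₊ : ℝ) := Nat.le_ceil _
  rw [meanL2]
  set K := ⌈Real.logb 2 (1 / ε)⌉₊
  have hK3 : (3 : ℝ) ≤ K := hL3.trans hLK
  have hpow : 1 / ε ≤ (2 : ℝ) ^ K := by
    rw [← Real.rpow_natCast]
    exact (Real.logb_le_iff_le_rpow (by norm_num) (by positivity)).1 hLK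
  have htrunc0 : 0 ≤ avg q ψ fun x => f x - if f x < 2 ^ K then f x else 0 :=
    avg_nonneg fun x => by
      split_ifs
      · simp
      · simpa using hf x
  -- The discarded values satisfy f ≥ 2^K ≥ 1/ε, hence f ≤ ε f².
  have htrunc1 : (avg q ψ fun x => f x - if f x < 2 ^ K then f x else 0) ≤ ε := by
    calc _ ≤ avg q ψ fun x => ε * f x ^ 2 := by
          refine avg_mono fun x => ?_
          split_ifs with h
          · rw [sub_self]; positivity
          · have h1 := hpow.trans (not_lt.1 h)
            rw [div_le_iff₀ hε] at h1
            nlinarith [hf x]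
      _ ≤ ε := by
          rw [avg_const_mul]
          exact mul_le_of_le_one_right hε.le hf2
  have hdecomp : (avg q ψ fun x => f x - if f x < 2 ^ K then f x else 0) = avg q ψ f -
      ((avg q ψ fun x => slice f 0 1 le_rfl x) +
        ∑ l ∈ Finset.range K, 2 ^ (l + 1) * avg q ψ fun x => dyadicSlice f l x) := by
    simp only [← avg_const_mul]
    rw [← avg_sum, ← avg_add, eq_sub_iff_add_eq, ← avg_add]
    congr 1
    ext x
    rw [sum_dyadicSlice hf]
    ring
  have hsqrt : √(avg q ψ fun x => (slice f 0 1 le_rfl x : ℝ)) ≤ 1 := by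
    refine Real.sqrt_le_one.2 (le_trans ?_ (avg_const (q := q) hψ 1).le)
    exact avg_mono fun x => (slice f 0 1 le_rfl x).2.2
  -- Failure budget: 1/10 for the slice [0,1) and 1/(10K) for each of the K others. The total 1/5 is
  -- the rate that `prob_powered_le` accepts.
  have hsum : (1 / 5 : ℝ) = 1 / 10 + (K * (1 / (10 * K)) + 0) := by
    field_simp
    norm_num
  rw [hsum]
  have h0 : 160 * √(avg q ψ fun x => (slice f 0 1 le_rfl x : ℝ)) / t + 6400 / (t : ℝ) ^ 2 ≤
      160 / t + 6400 / (t : ℝ) ^ 2 := by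
    gcongr
    linarith
  refine Prog.prob_bind_le hψ
    (prob_meanBounded_le hψ hc (by norm_num) (by norm_num) h0) (fun μ₀ hμ₀ => ?_) (by positivity)
  rw [add_zero]
  refine Prog.prob_map_le hψ (prob_sliceSum_le hψ f t hc (by positivity) ?_ K) fun s hs => ?_
  · rw [div_le_one (by positivity)]
    linarith
  · rw [hdecomp] at htrunc0 htrunc1
    simp only [Set.mem_ofPred_eq, Set.mem_Icc, abs_le] at hs hμ₀ ⊢
    constructor <;> linarith [hs.1, hs.2, hμ₀.1, hμ₀.2]

/-! ### Mean estimation for outputs with bounded variance -/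

theorem expect_sample (f : Bits k → ℝ) (g : ℝ → ℝ) :
    (sample q f).expect ψ g = avg q ψ fun x => g (f x) := by
  simp [sample, Prog.expect, finalState, Fintype.sum_prod_type, avg]

/-- Chebyshev's inequality at three standard deviations. -/
theorem prob_sample_le {f : Bits k → ℝ} {μ : ℝ} (h : (avg q ψ fun x => (f x - μ) ^ 2) ≤ 1) :
    (sample q f).prob ψ (Set.Icc (μ - 3) (μ + 3))ᶜ ≤ 1 / 9 := by
  rw [Prog.prob_eq_expect]
  calc _ ≤ (sample q f).expect ψ fun m => 1 / 9 * (m - μ) ^ 2 := by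
        refine Prog.expect_mono (fun m => ?_) _
        by_cases hm : m ∈ Set.Icc (μ - 3) (μ + 3)
        · rw [Set.indicator_of_notMem (by simpa using hm)]
          positivity
        · rw [Set.indicator_of_mem (by simpa using hm), Pi.one_apply]
          rw [Set.mem_Icc, not_and_or, not_le, not_le] at hm
          rcases hm with hm | hm <;> nlinarith
    _ ≤ 1 / 9 := by
        rw [Prog.expect_const_mul, expect_sample]
        linarith

theorem prob_meanVariance_le (hψ : ∑ z, ‖ψ z‖ ^ 2 = 1) {φ : Bits k → ℝ} {c σ ε μ : ℝ}
    (hμ : avg q ψ φ = μ) (hvar : (avg q ψ fun x => (φ x - μ) ^ 2) ≤ σ ^ 2) (hc : 10 ≤ c)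
    (hε : 0 < ε) (hσ : ε < 4 * σ) :
    (meanVariance 1000 c q φ σ ε).prob ψ {x | |x - μ| ≤ ε}ᶜ ≤ 1 / 3 := by
  have hσ0 : 0 < σ := by linarith
  have hε' : 0 < ε / (32 * σ) := by positivity
  have hε1 : ε / (32 * σ) ≤ 1 / 8 := by
    rw [div_le_div_iff₀ (by positivity) (by norm_num)]
    linarith
  have hvar1 : (avg q ψ fun x => (φ x / σ - μ / σ) ^ 2) ≤ 1 := by
    have : ∀ x, (φ x / σ - μ / σ) ^ 2 = 1 / σ ^ 2 * (φ x - μ) ^ 2 := fun x => by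
      field_simp
    simp only [this]
    rw [avg_const_mul, ← mul_le_mul_iff_right₀ (pow_pos hσ0 2), ← mul_assoc,
      mul_one_div_cancel (pow_pos hσ0 2).ne', one_mul, mul_one]
    exact hvar
  have hsum : (1 / 3 : ℝ) = 1 / 9 + (1 / 9 + 1 / 9) := by norm_num
  rw [meanVariance, hsum]
  refine Prog.prob_bind_le hψ (prob_sample_le hvar1) (fun m hm => ?_) (by norm_num)
  obtain ⟨b, hb⟩ : ∃ b : Bits k → ℝ, b = fun x => φ x / σ - m := ⟨_, rfl⟩
  have hb' : ∀ x, φ x / σ - m = b x := fun x => by rw [hb]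
  have hbmean : avg q ψ b = μ / σ - m := by
    have : b = fun x => 1 / σ * φ x + -m := by rw [hb]; ext x; ring
    rw [this, avg_add, avg_const_mul, avg_const hψ, hμ]
    ring
  -- Bias–variance decomposition: variance at most 1 plus squared bias at most 3² = 9.
  have hbsq : (avg q ψ fun x => b x ^ 2) ≤ 10 := by
    have : ∀ x, b x ^ 2 = (φ x / σ - μ / σ) ^ 2 +
        (2 * (μ / σ - m) * b x + -(μ / σ - m) ^ 2) := fun x => by
      rw [hb]; ring
    simp only [this]
    rw [avg_add, avg_add, avg_const_mul, avg_const hψ, hbmean]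
    have h9 : (μ / σ - m) ^ 2 ≤ 9 := by nlinarith [hm.1, hm.2]
    linarith
  simp only [hb']
  have hbig : ∀ g : Bits k → ℝ, (∀ x, 16 * g x ^ 2 ≤ b x ^ 2) → (avg q ψ fun x => g x ^ 2) ≤ 1 := by
    intro g hg
    have h1 := (avg_mono (q := q) (ψ := ψ) hg).trans hbsq
    rw [avg_const_mul] at h1
    linarith
  have hneg := prob_powered_le hψ (c := c) (δ := 1 / 9) (prob_meanL2_le (q := q)
    (f := fun x => -(if b x < 0 then b x else 0) / 4) hψ
    (fun x => by split_ifs <;> linarith)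
    (hbig _ fun x => by split_ifs <;> nlinarith [sq_nonneg (b x)]) hc hε' hε1)
    (by norm_num) hc (by norm_num)
  have hpos := prob_powered_le hψ (c := c) (δ := 1 / 9) (prob_meanL2_le (q := q)
    (f := fun x => (if 0 ≤ b x then b x else 0) / 4) hψ
    (fun x => by split_ifs <;> linarith)
    (hbig _ fun x => by split_ifs <;> nlinarith [sq_nonneg (b x)]) hc hε' hε1)
    (by norm_num) hc (by norm_num)
  refine Prog.prob_bind_le hψ hneg (fun μn hn => ?_) (by norm_num)
  refine Prog.prob_map_le hψ hpos fun μp hp => ?_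
  have hcomb : 4 * (avg q ψ fun x => (if 0 ≤ b x then b x else 0) / 4) +
      -4 * (avg q ψ fun x => -(if b x < 0 then b x else 0) / 4) = μ / σ - m := by
    rw [← hbmean, ← avg_const_mul, ← avg_const_mul, ← avg_add]
    congr 1
    ext x
    by_cases h : b x < 0
    · rw [if_pos h, if_neg (not_le.2 h)]; ring
    · rw [if_neg h, if_pos (not_lt.1 h)]; ring
  -- Each part is estimated within 4ε/(32σ) and multiplied by 4; the two parts together give the
  -- factor 32.
  have hfinal : |(m - 4 * μn + 4 * μp) - μ / σ| ≤ 32 * (ε / (32 * σ)) := by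
    rw [abs_le]
    constructor <;> linarith [hn.1, hn.2, hp.1, hp.2]
  rw [Set.mem_ofPred_eq]
  have h1 : σ * (m - 4 * μn + 4 * μp) - μ = σ * ((m - 4 * μn + 4 * μp) - μ / σ) := by
    field_simp
  rw [h1, abs_mul, abs_of_pos hσ0]
  calc _ ≤ σ * (32 * (ε / (32 * σ))) := mul_le_mul_of_nonneg_left hfinal hσ0.le
    _ = ε := by field_simp

end Estimators

/-! ### Measurement statistics of the given algorithm -/

namespace QAlg

variable {n k : ℕ} (A : QAlg n k)

theorem sum_norm_sq_state : ∑ z, ‖A.state z‖ ^ 2 = 1 := by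
  rw [state, sum_norm_sq_mulVec A.unitary.2, Finset.sum_eq_single fun _ => false]
  · simp
  · intro z _ h
    simp [h]
  · simp

theorem sum_outcomeProb_mul (g : Bits k → ℝ) :
    ∑ x, A.outcomeProb x * g x = avg A.qubits A.state g := by
  simp only [outcomeProb, Finset.sum_mul, avg]
  rw [Finset.sum_comm]
  simp [ite_mul]

end QAlg

namespace Prog

variable {n : ℕ} {α β : Type}

theorem copies_map_le {p : Prog n α} {g : α → β} {a : ℕ} (hp : p.copies ≤ a) :
    (p >>= fun x => pure (g x)).copies ≤ a :=
  copies_bind_le (b := 0) hp fun _ => le_rfl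

theorem uses_map_le {p : Prog n α} {g : α → β} {a : ℕ} (hp : p.uses ≤ a) :
    (p >>= fun x => pure (g x)).uses ≤ a :=
  uses_bind_le (b := 0) hp fun _ => le_rfl

end Prog

/-! ### Resources of the estimation algorithms -/

section Resources

variable {n k : ℕ} (q : Fin k ↪ Fin n)

theorem copies_ampEst_le (t : ℕ+) (f : Bits k → unitInterval) : (ampEst t q f).copies ≤ 1 := by
  simp [ampEst, Prog.copies]

theorem uses_ampEst_le (t : ℕ+) (f : Bits k → unitInterval) : (ampEst t q f).uses ≤ t := by
  have h : ∀ m : ℕ, (((List.range m).flatMap (groverGates t q f)).map Gate.uses).sum = m := by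
    intro m
    induction m with
    | zero => simp
    | succ m ih =>
      rw [List.range_succ, List.flatMap_append, List.map_append, List.sum_append, ih]
      simp [groverGates, Gate.uses]
  rw [ampEst, Prog.uses, ampEstGates, List.map_append, List.map_append, List.sum_append,
    List.sum_append, h]
  simp [Gate.uses]

theorem resources_meanBounded_le (c δ : ℝ) (t : ℕ+) (f : Bits k → unitInterval) :
    (meanBounded c q f t δ).copies ≤ ⌈c * Real.log (1 / δ)⌉₊ ∧
      (meanBounded c q f t δ).uses ≤ ⌈c * Real.log (1 / δ)⌉₊ * t :=
  ⟨(copies_powered_le c δ (copies_ampEst_le q t f)).trans_eq (mul_one _),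
    uses_powered_le c δ (uses_ampEst_le q t f)⟩

theorem resources_sliceSum_le (c δ : ℝ) (t : ℕ+) (f : Bits k → ℝ) (m : ℕ) :
    (sliceSum c q f t δ m).copies ≤ m * ⌈c * Real.log (1 / δ)⌉₊ ∧
      (sliceSum c q f t δ m).uses ≤ m * ⌈c * Real.log (1 / δ)⌉₊ * t := by
  induction m with
  | zero => simp [sliceSum]
  | succ m ih =>
    rw [sliceSum, Nat.succ_mul, Nat.add_mul]
    have h := resources_meanBounded_le q c δ t (slice f (2 ^ m) (2 ^ (m + 1)) (by positivity))
    exact ⟨Prog.copies_bind_le ih.1 fun s => Prog.copies_map_le h.1,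
      Prog.uses_bind_le ih.2 fun s => Prog.uses_map_le h.2⟩

/-- The number of amplitude estimations in `meanL2`. -/
noncomputable def ampEstCount (c ε : ℝ) : ℕ :=
  ⌈c * Real.log (1 / (1 / 10))⌉₊ + ⌈Real.logb 2 (1 / ε)⌉₊ *
    ⌈c * Real.log (1 / (1 / (10 * ⌈Real.logb 2 (1 / ε)⌉₊)))⌉₊

theorem resources_meanL2_le (D c ε : ℝ) (f : Bits k → ℝ) :
    (meanL2 D c q f ε).copies ≤ ampEstCount c ε ∧
      (meanL2 D c q f ε).uses ≤ ampEstCount c ε * iterations D ε := by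
  rw [meanL2, ampEstCount, Nat.add_mul]
  have h := resources_meanBounded_le q c (1 / 10) (iterations D ε) (slice f 0 1 le_rfl)
  have h' := resources_sliceSum_le q c (1 / (10 * ⌈Real.logb 2 (1 / ε)⌉₊)) (iterations D ε) f
    ⌈Real.logb 2 (1 / ε)⌉₊
  exact ⟨Prog.copies_bind_le h.1 fun s => Prog.copies_map_le h'.1,
    Prog.uses_bind_le h.2 fun s => Prog.uses_map_le h'.2⟩

theorem copies_meanVariance_le (D c σ ε : ℝ) (φ : Bits k → ℝ) :
    (meanVariance D c q φ σ ε).copies ≤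
      1 + (⌈c * Real.log (1 / (1 / 9))⌉₊ * ampEstCount c (ε / (32 * σ)) +
        ⌈c * Real.log (1 / (1 / 9))⌉₊ * ampEstCount c (ε / (32 * σ))) := by
  rw [meanVariance]
  refine Prog.copies_bind_le (by simp [sample, Prog.copies]) fun m => ?_
  exact Prog.copies_bind_le (copies_powered_le _ _ (resources_meanL2_le q D c _ _).1) fun _ =>
    Prog.copies_map_le (copies_powered_le _ _ (resources_meanL2_le q D c _ _).1)

theorem uses_meanVariance_le (D c σ ε : ℝ) (φ : Bits k → ℝ) :
    (meanVariance D c q φ σ ε).uses ≤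
      0 + (⌈c * Real.log (1 / (1 / 9))⌉₊ *
          (ampEstCount c (ε / (32 * σ)) * iterations D (ε / (32 * σ))) +
        ⌈c * Real.log (1 / (1 / 9))⌉₊ *
          (ampEstCount c (ε / (32 * σ)) * iterations D (ε / (32 * σ)))) := by
  rw [meanVariance]
  refine Prog.uses_bind_le (by simp [sample, Prog.uses]) fun m => ?_
  exact Prog.uses_bind_le (uses_powered_le _ _ (resources_meanL2_le q D c _ _).2) fun _ =>
    Prog.uses_map_le (uses_powered_le _ _ (resources_meanL2_le q D c _ _).2)

end Resources

/-! ### Numerical bounds for the resource counts -/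

theorem log_le_of_le_two_pow {x : ℝ} {m : ℕ} (hx : 0 < x) (h : x ≤ 2 ^ m) : Real.log x ≤ m := by
  calc Real.log x ≤ Real.log (2 ^ m) := Real.log_le_log hx h
    _ = m * Real.log 2 := Real.log_pow _ _
    _ ≤ m * 1 := by gcongr; linarith [Real.log_two_lt_d9]
    _ = m := mul_one _

theorem ceil_le_of_le {x y : ℝ} (hx : 0 ≤ x) (h : x ≤ y) : (⌈x⌉₊ : ℝ) ≤ y + 1 :=
  (Nat.ceil_lt_add_one hx).le.trans (by linarith)

/-- The number of amplitude estimations is `O(log x log log x)`, and the number of iterations of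
each is `O(r √(log x))`, for `r = σ / ε` and `x = max r 3`. -/
theorem exists_resource_bound : ∃ B : ℝ, 0 < B ∧ ∀ σ ε : ℝ, 0 < ε → ε < 4 * σ →
    1 ≤ B * (Real.log (max (σ / ε) 3) * Real.log (Real.log (max (σ / ε) 3))) ∧
    (ampEstCount 10 (ε / (32 * σ)) : ℝ) ≤
      B * (Real.log (max (σ / ε) 3) * Real.log (Real.log (max (σ / ε) 3))) ∧
    ((iterations 1000 (ε / (32 * σ)) : ℕ) : ℝ) ≤
      192000 * (σ / ε * √(Real.log (max (σ / ε) 3))) := by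
  have hlog3 : 1 < Real.log 3 := by
    rw [Real.lt_log_iff_exp_lt (by norm_num)]
    exact Real.exp_one_lt_d9.trans (by norm_num)
  obtain ⟨a, ha⟩ : ∃ a, a = Real.log (Real.log 3) := ⟨_, rfl⟩
  have ha0 : 0 < a := by rw [ha]; exact Real.log_pos hlog3
  -- With l = ln x and s = ln ln x, the maximum with 3 keeps s ≥ a > 0, so constants are absorbed at
  -- a cost of 1/a. The summands cover the constant 1, the repetitions for [0,1), and K ≤ 8l slices
  -- with at most (71/a + 10)s repetitions each.
  refine ⟨1 / a + 41 / a + 8 * (71 / a + 10), by positivity, fun σ ε hε hσ => ?_⟩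
  have hσ0 : 0 < σ := by linarith
  obtain ⟨r, hr⟩ : ∃ r, r = σ / ε := ⟨_, rfl⟩
  have hr4 : 1 / 4 < r := by rw [hr, lt_div_iff₀ hε]; linarith
  rw [← hr]
  obtain ⟨l, hl⟩ : ∃ l, l = Real.log (max r 3) := ⟨_, rfl⟩
  have hl3 : Real.log 3 ≤ l := by
    rw [hl]; exact Real.log_le_log (by norm_num) (le_max_right _ _)
  have hl1 : 1 < l := by linarith
  have hll : a ≤ Real.log l := by rw [ha]; exact Real.log_le_log (by linarith) hl3
  rw [← hl]
  obtain ⟨s, hs⟩ : ∃ s, s = Real.log l := ⟨_, rfl⟩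
  rw [← hs] at hll ⊢
  have hs0 : 0 < s := by linarith
  have hls : 1 ≤ 1 / a * (l * s) := by
    rw [one_div_mul_eq_div, le_div_iff₀ ha0]
    nlinarith
  have hlls : l ≤ 1 / a * (l * s) := by
    rw [one_div_mul_eq_div, le_div_iff₀ ha0]
    nlinarith
  have hε' : 0 < ε / (32 * σ) := by positivity
  have hinv : 1 / (ε / (32 * σ)) = 32 * r := by rw [hr]; field_simp
  have hL3 : 3 ≤ Real.logb 2 (1 / (ε / (32 * σ))) := by
    rw [hinv, Real.le_logb_iff_rpow_le (by norm_num) (by positivity)]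
    norm_num
    linarith
  have hLl : Real.logb 2 (1 / (ε / (32 * σ))) ≤ 7 * l := by
    rw [hinv]
    calc Real.logb 2 (32 * r) ≤ Real.logb 2 (32 * max r 3) :=
          Real.logb_le_logb_of_le (by norm_num) (by positivity)
            (by linarith [le_max_left r 3])
      _ = 5 + l / Real.log 2 := by
          rw [Real.logb_mul (by norm_num) (by positivity), hl, Real.log_div_log,
            show (32 : ℝ) = 2 ^ (5 : ℕ) by norm_num, Real.logb_pow, Real.logb_self_eq_one (by norm_num)]
          norm_num
      _ ≤ 5 + 2 * l := by
          rw [add_le_add_iff_left, div_le_iff₀ (Real.log_pos (by norm_num))]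
          nlinarith [Real.log_two_gt_d9]
      _ ≤ 7 * l := by linarith
  refine ⟨?_, ?_, ?_⟩
  · have : 0 ≤ (41 / a + 8 * (71 / a + 10)) * (l * s) := by positivity
    linarith
  · rw [ampEstCount]
    set L := Real.logb 2 (1 / (ε / (32 * σ)))
    have hLK : L ≤ (⌈L⌉₊ : ℝ) := Nat.le_ceil _
    have hK : (⌈L⌉₊ : ℝ) ≤ 8 * l := (ceil_le_of_le (by linarith) hLl).trans (by linarith)
    obtain ⟨K, hKdef⟩ : ∃ K, K = ⌈L⌉₊ := ⟨_, rfl⟩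
    rw [← hKdef] at hLK hK ⊢
    have hR : (⌈10 * Real.log (1 / (1 / 10))⌉₊ : ℝ) ≤ 41 := by
      have h10 : Real.log 10 ≤ (4 : ℕ) := log_le_of_le_two_pow (by norm_num) (by norm_num)
      have h0 : 0 ≤ Real.log 10 := Real.log_nonneg (by norm_num)
      push_cast at h10
      rw [one_div_one_div]
      exact (ceil_le_of_le (y := 40) (by positivity) (by linarith)).trans (by norm_num)
    have hR' : (⌈10 * Real.log (1 / (1 / (10 * (K : ℝ))))⌉₊ : ℝ) ≤ (71 / a + 10) * s := by
      have h80 : Real.log 80 ≤ (7 : ℕ) := log_le_of_le_two_pow (by norm_num) (by norm_num)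
      push_cast at h80
      have h1 : Real.log (10 * K) ≤ 7 + s := by
        calc Real.log (10 * K) ≤ Real.log (80 * l) := Real.log_le_log (by linarith) (by linarith)
          _ = Real.log 80 + s := by rw [Real.log_mul (by norm_num) (by linarith), hs]
          _ ≤ 7 + s := by linarith
      have h0 : 0 ≤ Real.log (10 * K) := Real.log_nonneg (by linarith)
      rw [one_div_one_div]
      refine (ceil_le_of_le (y := 10 * (7 + s)) (by positivity) (by linarith)).trans ?_
      have : 71 ≤ 71 / a * s := by
        rw [div_mul_eq_mul_div, le_div_iff₀ ha0]
        linarith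
      linarith
    push_cast
    have h2 : (K : ℝ) * (⌈10 * Real.log (1 / (1 / (10 * (K : ℝ))))⌉₊ : ℝ) ≤
        8 * l * ((71 / a + 10) * s) := by gcongr
    have h3 : 41 / a * (l * s) = 41 * (1 / a * (l * s)) := by ring
    have h4 : 0 ≤ 1 / a * (l * s) := by positivity
    linarith
  · have hw1 : 1 ≤ √(Real.logb 2 (1 / (ε / (32 * σ)))) := by
      rw [Real.one_le_sqrt]; linarith
    have hw2 : √(Real.logb 2 (1 / (ε / (32 * σ)))) ≤ 3 * √l := by
      rw [Real.sqrt_le_iff]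
      refine ⟨by positivity, ?_⟩
      rw [mul_pow, Real.sq_sqrt (by linarith)]
      linarith
    -- 32000 · 3 = 96000; the rounding term 1 is at most 4r√L because r > 1/4, and doubling to
    -- 192000 absorbs it.
    have hdiv : ∀ y : ℝ, 1000 * y / (ε / (32 * σ)) = 32000 * (r * y) := by
      intro y
      rw [hr]; field_simp; ring
    have ht := (le_iterations (D := 1000) (ε := ε / (32 * σ)) (by positivity)).2
    rw [hdiv] at ht
    have h1 : r * √(Real.logb 2 (1 / (ε / (32 * σ)))) ≤ r * (3 * √l) := by gcongr
    have h2 : 1 / 4 ≤ r * √(Real.logb 2 (1 / (ε / (32 * σ)))) := by nlinarith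
    linarith

end QMean

/-! ### The main theorem -/

theorem mainTheorem1 :
    ∃ D c K : ℝ, 0 < D ∧ 0 < c ∧ 0 < K ∧
      ∀ (n k : ℕ) (A : QMean.QAlg n k) (σ ε : ℝ),
        A.variance ≤ σ ^ 2 → 0 < ε → ε < 4 * σ →
          ((QMean.meanVariance D c A.qubits A.φ σ ε).copies : ℝ) ≤
              K * (Real.log (max (σ / ε) 3) * Real.log (Real.log (max (σ / ε) 3))) ∧
          ((QMean.meanVariance D c A.qubits A.φ σ ε).uses : ℝ) ≤
              K * (σ / ε * Real.log (max (σ / ε) 3) ^ (3 / 2 : ℝ) *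
                Real.log (Real.log (max (σ / ε) 3))) ∧
          2 / 3 ≤ (QMean.meanVariance D c A.qubits A.φ σ ε).prob A.state
              {μ | |μ - A.mean| ≤ ε} := by
  obtain ⟨B, hB0, hB⟩ := QMean.exists_resource_bound
  -- 83 = 2 · 41 + 1: two calls, each powered at most 41 times, plus the initial sample. The factor
  -- 192000 is needed only for the uses of U.
  refine ⟨1000, 10, 83 * B * 192000, by norm_num, by norm_num, by positivity, ?_⟩
  intro n k A σ ε hvar hε hσ
  obtain ⟨h1, hcount, hiter⟩ := hB σ ε hε hσ
  have hR : (⌈10 * Real.log (1 / (1 / 9))⌉₊ : ℝ) ≤ 41 := by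
    have h9 : Real.log 9 ≤ (4 : ℕ) := QMean.log_le_of_le_two_pow (by norm_num) (by norm_num)
    have h0 : 0 ≤ Real.log 9 := Real.log_nonneg (by norm_num)
    push_cast at h9
    rw [one_div_one_div]
    exact (QMean.ceil_le_of_le (y := 40) (by positivity) (by linarith)).trans (by norm_num)
  refine ⟨?_, ?_, ?_⟩
  · have h := QMean.copies_meanVariance_le A.qubits 1000 10 σ ε A.φ
    have h' : ((QMean.meanVariance 1000 10 A.qubits A.φ σ ε).copies : ℝ) ≤ _ := Nat.cast_le.2 h
    push_cast at h'
    have h2 := mul_le_mul hR hcount (Nat.cast_nonneg _) (by norm_num)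
    linarith
  · have h := QMean.uses_meanVariance_le A.qubits 1000 10 σ ε A.φ
    have h' : ((QMean.meanVariance 1000 10 A.qubits A.φ σ ε).uses : ℝ) ≤ _ := Nat.cast_le.2 h
    push_cast at h'
    have h2 := mul_le_mul hcount hiter (Nat.cast_nonneg _) ((Nat.cast_nonneg _).trans hcount)
    have h3 := mul_le_mul hR h2 (by positivity) (by norm_num)
    have hl : 0 < Real.log (max (σ / ε) 3) :=
      Real.log_pos (lt_of_lt_of_le (by norm_num) (le_max_right _ _))
    have hpow : Real.log (max (σ / ε) 3) ^ (3 / 2 : ℝ) =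
        Real.log (max (σ / ε) 3) * √(Real.log (max (σ / ε) 3)) := by
      rw [Real.sqrt_eq_rpow, ← Real.rpow_one_add' hl.le (by norm_num)]
      norm_num
    rw [hpow]
    linarith
  · have hmean : QMean.avg A.qubits A.state A.φ = A.mean := (A.sum_outcomeProb_mul A.φ).symm
    rw [QMean.QAlg.variance, A.sum_outcomeProb_mul fun x => (A.φ x - A.mean) ^ 2] at hvar
    have h := QMean.prob_meanVariance_le A.sum_norm_sq_state hmean hvar le_rfl hε hσ
    rw [QMean.Prog.prob_compl A.sum_norm_sq_state] at h
    linarith
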